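/- **Theorem.** For a finite set $P\subset\mathbb R^d$ and a tuple $S=(s_1,\dots,s_k)$ of $k\ge 1$ centers in $\mathbb R^d$ write $\mathrm{cost}(p,S)=\min_i\|p-s_i\|_2$, $\mathrm{cost}(P,S)=\sum_{p\in P}\mathrm{cost}(p,S)$, and $\mathrm{OPT}_k=\inf_{S}\mathrm{cost}(P,S)$ over all $k$-tuples $S$ (with $\mathrm{OPT}_0=+\infty$). The set $P$ is *$\beta$-stable* for the $k$-median objective if $(1+\beta)\,\mathrm{OPT}_k\le \mathrm{OPT}_{k-1}$. Points $q_1,\dots,q_m\in\mathbb R^d$ (repetitions allowed) with weights $w_1,\dots,w_m$ form an *$\varepsilon$-coreset* of $P$ if for every $k$-tuple $S$ of centers $$(1-\varepsilon)\,\mathrm{cost}(P,S)\ \le\ \sum_{i=1}^m w_i\,\mathrm{cost}(q_i,S)\ \le\ (1+\varepsilon)\,\mathrm{cost}(P,S).$$ *Sensitivity Sampling* with $m$ samples, started from a $\gamma$-approximate $k$-median solution $A=(a_1,\dots,a_k)$, i.e. $\mathrm{cost}(P,A)\le\gamma\,\mathrm{OPT}_k$, does the following. Partition $P$ into clusters $C_1,\dots,C_k$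 by assigning every point to a nearest center of $A$ (ties broken arbitrarily). Let $\mu$ be the probability distribution on $P$ given, for $p\in C_j$, by $$\mu(p)=\frac14\left(\frac1{k|C_j|}+\frac{\mathrm{cost}(p,A)}{k\,\mathrm{cost}(C_j,A)}+\frac{\mathrm{cost}(p,A)}{\mathrm{cost}(P,A)}+\frac{\Delta_p}{\mathrm{cost}(P,A)}\right),\qquad \Delta_p=\frac{\mathrm{cost}(C_j,A)}{|C_j|},$$ where, if some cluster is empty or has cost $0$, one reads $0/0=0$ and divides the right-hand side by its sum over $P$. Draw $q_1,\dots,q_m$ independently from $\mu$ and give $q_i$ the weight $w_i=1/(m\,\mu(q_i))$. Then for every $\gamma\ge1$ there are constants $C>0$ and $c\in\mathbb N$, depending only on $\gamma$, such that the following holds. Let $d\ge 0$ and $k\ge1$ be integers, let $\beta>0$ and $0<\varepsilon<1$, let $P\subset\mathbb R^d$ be a non-empty finite set that is $\beta$-stable for the $k$-median objective, and let $A$ be a $\gamma$-approximate $k$-median solution for $P$. If $$m\ \ge\ C\,\frac{k}{\varepsilon^{2}}\,\max(1,\beta^{-1})\,\bigl(1+\log(k/\varepsilon)\bigr)^{c},$$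 then with probability at least $2/3$ the weighted points produced by Sensitivity Sampling with $m$ samples form an $\varepsilon$-coreset of $P$. -/

import Mathlib

open MeasureTheory

namespace KMedian

noncomputable section

/-- `d`-dimensional Euclidean space. -/
abbrev Pt (d : ℕ) : Type := EuclideanSpace ℝ (Fin d)

/-- `cost(p, S)`: the distance of `p` to the nearest of the `k` centers `S` (used for `k ≥ 1`). -/
def ptCost {d k : ℕ} (p : Pt d) (S : Fin k → Pt d) : ℝ := ⨅ i, dist p (S i)

/-- `cost(P, S)`: the `k`-median cost of the finite set `P` with respect to the centers `S`. -/
def cost {d k : ℕ} (P : Finset (Pt d)) (S : Fin k → Pt d) : ℝ := ∑ p ∈ P, ptCost p S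

/-- `OPT_k`: the optimal `k`-median cost of `P` (used for `k ≥ 1`). -/
def opt {d : ℕ} (P : Finset (Pt d)) (k : ℕ) : ℝ := ⨅ S : Fin k → Pt d, cost P S

/-- `P` is `β`-stable for the `k`-median objective: `(1 + β) OPT_k ≤ OPT_{k-1}`. For `k = 1` there
is no solution with `k - 1` centers, `OPT_0 = +∞`, and the inequality holds. -/
def IsStable {d : ℕ} (P : Finset (Pt d)) (k : ℕ) (β : ℝ) : Prop :=
  2 ≤ k → opt P k * (1 + β) ≤ opt P (k - 1)

/-- `A` is a `γ`-approximate `k`-median solution for `P`. -/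
def IsApprox {d k : ℕ} (γ : ℝ) (P : Finset (Pt d)) (A : Fin k → Pt d) : Prop :=
  cost P A ≤ γ * opt P k

/-- `σ` assigns every point of `P` to a nearest center of `A` (ties broken arbitrarily). -/
def IsNearest {d k : ℕ} (P : Finset (Pt d)) (A : Fin k → Pt d) (σ : Pt d → Fin k) : Prop :=
  ∀ p ∈ P, ∀ i, dist p (A (σ p)) ≤ dist p (A i)

/-- The cluster `C_j`: the points of `P` that are assigned to the `j`-th center. -/
def cluster {d k : ℕ} (P : Finset (Pt d)) (σ : Pt d → Fin k) (j : Fin k) : Finset (Pt d) :=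
  P.filter fun p => σ p = j

/-- `Δ_p = cost(C_j, A) / |C_j|`, the average cost of the cluster `C_j` that contains `p`. -/
def avgCost {d k : ℕ} (P : Finset (Pt d)) (A : Fin k → Pt d) (σ : Pt d → Fin k) (p : Pt d) : ℝ :=
  cost (cluster P σ (σ p)) A / ((cluster P σ (σ p)).card : ℝ)

/-- The sampling scores of Sensitivity Sampling, with `0 / 0 = 0`. They sum to `1` over `P` if every
cluster is non-empty and has positive cost. -/
def score {d k : ℕ} (P : Finset (Pt d)) (A : Fin k → Pt d) (σ : Pt d → Fin k) (p : Pt d) : ℝ :=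
  1 / 4 * (1 / ((k : ℝ) * ((cluster P σ (σ p)).card : ℝ))
    + ptCost p A / ((k : ℝ) * cost (cluster P σ (σ p)) A)
    + ptCost p A / cost P A
    + avgCost P A σ p / cost P A)

/-- The sampling probability `μ(p)`: the score, divided by the sum of all scores (that sum is `1`
unless some cluster is empty or has cost `0`). -/
def mu {d k : ℕ} (P : Finset (Pt d)) (A : Fin k → Pt d) (σ : Pt d → Fin k) (p : Pt d) : ℝ :=
  score P A σ p / ∑ x ∈ P, score P A σ x

theorem ptCost_nonneg {d k : ℕ} (p : Pt d) (S : Fin k → Pt d) : 0 ≤ ptCost p S :=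
  Real.iInf_nonneg fun _ => dist_nonneg

theorem cost_nonneg {d k : ℕ} (P : Finset (Pt d)) (S : Fin k → Pt d) : 0 ≤ cost P S :=
  Finset.sum_nonneg fun p _ => ptCost_nonneg p S

theorem score_pos {d k : ℕ} (P : Finset (Pt d)) (A : Fin k → Pt d) (σ : Pt d → Fin k) (p : Pt d)
    (hp : p ∈ P) : 0 < score P A σ p := by
  have hk : (0 : ℝ) < k := by exact_mod_cast (σ p).pos
  have hc : (0 : ℝ) < ((cluster P σ (σ p)).card : ℝ) := by
    have : p ∈ cluster P σ (σ p) := by simp [cluster, hp]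
    exact_mod_cast Finset.card_pos.mpr ⟨p, this⟩
  have h1 := ptCost_nonneg p A
  have h2 := cost_nonneg P A
  have h3 := cost_nonneg (cluster P σ (σ p)) A
  have h4 : 0 ≤ avgCost P A σ p := div_nonneg h3 hc.le
  unfold score
  positivity

theorem sum_ofReal_mu {d k : ℕ} (P : Finset (Pt d)) (hP : P.Nonempty) (A : Fin k → Pt d)
    (σ : Pt d → Fin k) : ∑ p : {x // x ∈ P}, ENNReal.ofReal (mu P A σ p) = 1 := by
  have hpos : 0 < ∑ x ∈ P, score P A σ x := Finset.sum_pos (fun p hp => score_pos P A σ p hp) hP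
  have hnn : ∀ p ∈ (Finset.univ : Finset {x // x ∈ P}), 0 ≤ mu P A σ p := fun p _ =>
    div_nonneg (score_pos P A σ p p.2).le hpos.le
  rw [← ENNReal.ofReal_sum_of_nonneg hnn]
  rw [Finset.sum_coe_sort P (fun p => mu P A σ p)]
  unfold mu
  rw [← Finset.sum_div, div_self hpos.ne', ENNReal.ofReal_one]

/-- The distribution `μ` on `P`. -/
def samplingPMF {d k : ℕ} (P : Finset (Pt d)) (hP : P.Nonempty) (A : Fin k → Pt d)
    (σ : Pt d → Fin k) : PMF {x // x ∈ P} :=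
  PMF.ofFintype (fun p => ENNReal.ofReal (mu P A σ p)) (sum_ofReal_mu P hP A σ)

/-- The law of the `m` independent samples `q_1, …, q_m` from `μ`. -/
def sampleLaw {d k : ℕ} (P : Finset (Pt d)) (hP : P.Nonempty) (A : Fin k → Pt d)
    (σ : Pt d → Fin k) (m : ℕ) : Measure (Fin m → {x // x ∈ P}) :=
  Measure.pi fun _ => (samplingPMF P hP A σ).toMeasure

/-- The weight `1 / (m μ(p))` that a sampled point `p` receives. -/
def sampleWeight {d k : ℕ} (P : Finset (Pt d)) (A : Fin k → Pt d) (σ : Pt d → Fin k) (m : ℕ)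
    (p : Pt d) : ℝ :=
  1 / ((m : ℝ) * mu P A σ p)

/-- The points `q_1, …, q_m` (repetitions allowed) with weights `w_1, …, w_m` form an `ε`-coreset of
`P` for `k`-median: for all `k`-tuples of centers the weighted cost is within `(1 ± ε) cost(P, S)`. -/
def IsCoreset {d m : ℕ} (P : Finset (Pt d)) (k : ℕ) (ε : ℝ) (q : Fin m → Pt d) (w : Fin m → ℝ) :
    Prop :=
  ∀ S : Fin k → Pt d,
    (1 - ε) * cost P S ≤ ∑ i, w i * ptCost (q i) S ∧
      ∑ i, w i * ptCost (q i) S ≤ (1 + ε) * cost P S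

end

end KMedian

/-! Let a_p be the center of A that serves p, and split cost(p, S) = relCost(a_p, p, S) + cost(a_p,
S). Both parts are estimated uniformly in S. The second part is constant on each cluster, so it only
requires the k cluster sizes to be estimated within a factor 1 ± ε/(2(1+γ)) (`prob_badSizes_le`);
this suffices because ∑ cost(a_p, S) ≤ (1+γ) cost(P, S).

The relative costs satisfy |relCost| ≤ cost(p, A), so after importance weighting they are at most 4
cost(P, A). Their uniform deviation is bounded by `symmetrization` and `chaining`, once tuples S can
be encoded with relative accuracy of order 2^(-h) by codes whose log-number is 4^h k(1+x) up to
logarithms (`exists_center_code`). The codes do not depend on the dimension, since directions are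
approximated by greedy sums of O(4^h) vectors. Here x bounds the number of ambiguous clusters: those
whose center has at least two centers of S within a factor 3 of the nearest. Seen from far away, an
unambiguous cluster is served by a single center of S, while an ambiguous one needs data on all k
centers.

Stability controls x. At most k - x/4 centers of S still serve every center of A up to a factor 3
(`exists_transversal`), and a stable instance charges of the order of β OPT_k for each center saved
(`mul_opt_le_of_isStable`). Hence x β OPT_k ≤ 8 (3 cost(P, S) + 4 cost(P, A))
(`card_ambiguous_mul_opt_le`), so a solution with large x is expensive and may be estimated with a
larger additive error. Up to factors depending on γ, the deviation grows like √(1+x), the permitted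
error like max(1, βx), and (1+x)/max(1, βx)² = O(max(1, 1/β)). A union bound over the O(log k)
dyadic ranges of x gives the sample size. -/

namespace KMedian

/-! ### Finite expectations, symmetrization, Massart's lemma and chaining. -/

section Expectation

/-- The expectation of `F` over `m` independent draws from the weights `μ` on a finite type. -/
noncomputable def expect {α : Type*} [Fintype α] (μ : α → ℝ) {m : ℕ} (F : (Fin m → α) → ℝ) : ℝ :=
  ∑ q, (∏ i, μ (q i)) * F q

variable {α : Type*} [Fintype α] {μ : α → ℝ} {m : ℕ}

theorem expect_prod (μ : α → ℝ) (g : Fin m → α → ℝ) :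
    expect μ (fun q => ∏ i, g i (q i)) = ∏ i, ∑ x, μ x * g i x := by
  classical
  rw [Finset.prod_univ_sum, Fintype.piFinset_univ]
  simp only [expect, Finset.prod_mul_distrib]

theorem expect_one (h1 : ∑ x, μ x = 1) : expect μ (fun _ : Fin m → α => (1 : ℝ)) = 1 := by
  have := expect_prod (m := m) μ (fun _ _ => 1)
  simpa [h1] using this

theorem expect_add (F G : (Fin m → α) → ℝ) :
    expect μ (fun q => F q + G q) = expect μ F + expect μ G := by
  simp only [expect, mul_add, Finset.sum_add_distrib]

theorem expect_const_mul (c : ℝ) (F : (Fin m → α) → ℝ) :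
    expect μ (fun q => c * F q) = c * expect μ F := by
  simp only [expect, Finset.mul_sum]
  exact Finset.sum_congr rfl fun q _ => by ring

theorem expect_const (h1 : ∑ x, μ x = 1) (c : ℝ) : expect μ (fun _ : Fin m → α => c) = c := by
  have := expect_const_mul (μ := μ) (m := m) c (fun _ => 1)
  rw [expect_one h1] at this
  simpa using this

theorem expect_sub (F G : (Fin m → α) → ℝ) :
    expect μ (fun q => F q - G q) = expect μ F - expect μ G := by
  simp only [expect, mul_sub, Finset.sum_sub_distrib]

theorem expect_sum {ι : Type*} (s : Finset ι) (F : ι → (Fin m → α) → ℝ) :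
    expect μ (fun q => ∑ i ∈ s, F i q) = ∑ i ∈ s, expect μ (F i) := by
  simp only [expect, Finset.mul_sum]
  exact Finset.sum_comm

theorem expect_mono (h0 : ∀ x, 0 ≤ μ x) {F G : (Fin m → α) → ℝ} (h : ∀ q, F q ≤ G q) :
    expect μ F ≤ expect μ G :=
  Finset.sum_le_sum fun q _ =>
    mul_le_mul_of_nonneg_left (h q) (Finset.prod_nonneg fun _ _ => h0 _)

theorem abs_expect_le (h0 : ∀ x, 0 ≤ μ x) (F : (Fin m → α) → ℝ) :
    |expect μ F| ≤ expect μ (fun q => |F q|) := by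
  refine (Finset.abs_sum_le_sum_abs _ _).trans (le_of_eq (Finset.sum_congr rfl fun q _ => ?_))
  rw [abs_mul, abs_of_nonneg (Finset.prod_nonneg fun _ _ => h0 _)]

theorem expect_apply (h1 : ∑ x, μ x = 1) (g : α → ℝ) (i : Fin m) :
    expect μ (fun q => g (q i)) = ∑ x, μ x * g x := by
  classical
  have h := expect_prod μ (fun (l : Fin m) x => if l = i then g x else 1)
  have e1 : (fun q : Fin m → α => ∏ l, (if l = i then g (q l) else 1)) = fun q => g (q i) := by
    funext q
    simp
  rw [e1] at h
  rw [h, Finset.prod_eq_single i]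
  · simp
  · intro l _ hl
    simp [hl, h1]
  · simp

theorem le_iSup_of_fintype {ι : Type*} [Finite ι] (f : ι → ℝ) (t : ι) : f t ≤ ⨆ s, f s :=
  le_ciSup (Set.finite_range f).bddAbove t

/-- A random sign. -/
def sgn (b : Bool) : ℝ := if b then 1 else -1

theorem abs_sgn (b : Bool) : |sgn b| = 1 := by cases b <;> simp [sgn]

/-- The expectation over `m` independent uniform bits. -/
noncomputable def signExpect {m : ℕ} (F : (Fin m → Bool) → ℝ) : ℝ := expect (fun _ => 1 / 2) F

theorem half_nonneg : ∀ _x : Bool, (0 : ℝ) ≤ 1 / 2 := fun _ => by norm_num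

theorem sum_half : ∑ _x : Bool, (1 / 2 : ℝ) = 1 := by norm_num

theorem expect_swap (q : (Fin m → α) → (Fin m → α) → ℝ) (e : Fin m → Bool) :
    expect μ (fun a => expect μ (fun b => q a b)) =
      expect μ (fun a => expect μ (fun b =>
        q (fun i => if e i then a i else b i) (fun i => if e i then b i else a i))) := by
  classical
  let Φ : ((Fin m → α) × (Fin m → α)) → ((Fin m → α) × (Fin m → α)) := fun z =>
    (fun i => if e i then z.1 i else z.2 i, fun i => if e i then z.2 i else z.1 i)
  have hΦ : Function.Involutive Φ := by
    rintro ⟨a, b⟩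
    simp only [Φ, Prod.mk.injEq]
    constructor <;> funext i <;> by_cases h : e i <;> simp [h]
  have key : ∀ r : (Fin m → α) → (Fin m → α) → ℝ,
      expect μ (fun a => expect μ (fun b => r a b)) =
        ∑ z : (Fin m → α) × (Fin m → α), (∏ i, μ (z.1 i) * μ (z.2 i)) * r z.1 z.2 := by
    intro r
    rw [Fintype.sum_prod_type]
    simp only [expect, Finset.mul_sum, Finset.prod_mul_distrib, mul_assoc]
  rw [key, key, ← Equiv.sum_comp (Function.Involutive.toPerm Φ hΦ)]
  refine Finset.sum_congr rfl fun z _ => ?_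
  change (∏ i, μ ((Φ z).1 i) * μ ((Φ z).2 i)) * q (Φ z).1 (Φ z).2 = _
  congr 1
  refine Finset.prod_congr rfl fun i _ => ?_
  by_cases h : e i <;> simp [Φ, h, mul_comm]

theorem abs_sum_le_iSup {ι : Type*} [Finite ι] (f : ι → ℝ) (t : ι) : |f t| ≤ ⨆ s, |f s| :=
  le_iSup_of_fintype (fun s => |f s|) t

/-- An independent ghost sample replaces the mean. Exchanging the two samples on any set of
coordinates preserves their joint law, so the bound `s2` holds for every fixed sign pattern and can
then be averaged over the signs. -/
theorem symmetrization {ι : Type*} [Finite ι] [Nonempty ι] (h0 : ∀ x, 0 ≤ μ x)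
    (h1 : ∑ x, μ x = 1) (f : ι → α → ℝ) :
    expect μ (fun q : Fin m → α => ⨆ t, |∑ i, f t (q i) - (m : ℝ) * ∑ x, μ x * f t x|) ≤
      2 * expect μ (fun q : Fin m → α => signExpect fun e => ⨆ t, |∑ i, sgn (e i) * f t (q i)|) := by
  set B : ℝ := expect μ (fun a : Fin m → α => expect μ (fun b : Fin m → α =>
    ⨆ t, |∑ i, (f t (a i) - f t (b i))|)) with hB
  have s1 : expect μ (fun q : Fin m → α => ⨆ t, |∑ i, f t (q i) - (m : ℝ) * ∑ x, μ x * f t x|) ≤ B := by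
    refine expect_mono h0 fun a => ciSup_le fun t => ?_
    have e : ∑ i, f t (a i) - (m : ℝ) * ∑ x, μ x * f t x =
        expect μ (fun b : Fin m → α => ∑ i, (f t (a i) - f t (b i))) := by
      simp only [Finset.sum_sub_distrib]
      rw [expect_sub, expect_const h1, expect_sum]
      simp [expect_apply h1]
    rw [e]
    exact (abs_expect_le h0 _).trans
      (expect_mono h0 fun b => abs_sum_le_iSup (fun t => ∑ i, (f t (a i) - f t (b i))) t)
  have s2 : ∀ e : Fin m → Bool, B ≤
      2 * expect μ (fun q : Fin m → α => ⨆ t, |∑ i, sgn (e i) * f t (q i)|) := by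
    intro e
    rw [hB, expect_swap _ e]
    have : ∀ a b : Fin m → α, (⨆ t, |∑ i, (f t (if e i then a i else b i) -
        f t (if e i then b i else a i))|) ≤
        (⨆ t, |∑ i, sgn (e i) * f t (a i)|) + ⨆ t, |∑ i, sgn (e i) * f t (b i)| := by
      intro a b
      refine ciSup_le fun t => ?_
      have e1 : ∑ i, (f t (if e i then a i else b i) - f t (if e i then b i else a i)) =
          ∑ i, sgn (e i) * f t (a i) - ∑ i, sgn (e i) * f t (b i) := by
        rw [← Finset.sum_sub_distrib]
        refine Finset.sum_congr rfl fun i _ => ?_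
        by_cases h : e i <;> simp [h, sgn]
        ring
      rw [e1]
      exact (abs_sub _ _).trans (add_le_add
        (abs_sum_le_iSup (fun t => ∑ i, sgn (e i) * f t (a i)) t)
        (abs_sum_le_iSup (fun t => ∑ i, sgn (e i) * f t (b i)) t))
    refine (expect_mono h0 fun a => expect_mono h0 fun b => this a b).trans (le_of_eq ?_)
    simp only [expect_add, expect_const h1]
    ring
  have s3 : B ≤ signExpect fun e : Fin m → Bool =>
      2 * expect μ (fun q : Fin m → α => ⨆ t, |∑ i, sgn (e i) * f t (q i)|) := by
    have := expect_mono (m := m) half_nonneg s2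
    rwa [expect_const sum_half] at this
  refine s1.trans (s3.trans (le_of_eq ?_))
  unfold signExpect
  rw [expect_const_mul]
  congr 1
  simp only [expect, Finset.mul_sum]
  rw [Finset.sum_comm]
  exact Finset.sum_congr rfl fun q _ => Finset.sum_congr rfl fun e _ => by ring

/-- Independence factorizes the left side into values of cosh, and cosh x ≤ exp (x² / 2). -/
theorem signExpect_exp (v : Fin m → ℝ) :
    signExpect (fun e : Fin m → Bool => Real.exp (∑ i, sgn (e i) * v i)) ≤
      Real.exp ((∑ i, v i ^ 2) / 2) := by
  simp only [Real.exp_sum]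
  unfold signExpect
  rw [expect_prod (fun _ => 1 / 2) (fun i b => Real.exp (sgn b * v i)), Finset.sum_div,
    Real.exp_sum]
  refine Finset.prod_le_prod (fun i _ => Finset.sum_nonneg fun b _ => by positivity) fun i _ => ?_
  refine le_trans (le_of_eq ?_) (Real.cosh_le_exp_half_sq (v i))
  rw [Fintype.sum_bool, Real.cosh_eq]
  simp [sgn]
  ring

theorem exp_expect_le (h0 : ∀ x, 0 ≤ μ x) (h1 : ∑ x, μ x = 1) (F : (Fin m → α) → ℝ) :
    Real.exp (expect μ F) ≤ expect μ (fun q => Real.exp (F q)) := by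
  have := convexOn_exp.map_sum_le (t := Finset.univ) (w := fun q : Fin m → α => ∏ i, μ (q i))
    (p := F) (fun q _ => Finset.prod_nonneg fun _ _ => h0 _)
    (by have := expect_one (m := m) h1; simpa [expect] using this) (fun _ _ => Set.mem_univ _)
  simpa [expect] using this

/-- Massart's finite class lemma; `N` bounds the number of distinct vectors `v t`. -/
theorem massart {ι : Type*} [Fintype ι] [Nonempty ι] (v : ι → Fin m → ℝ) (s L : ℝ)
    (hs : ∀ t, ∑ i, v t i ^ 2 ≤ s) (N : ℝ)
    (hN : ((Set.range v).ncard : ℝ) ≤ N) (hL : Real.log (2 * N) ≤ L) (l : ℝ) (hl : 0 < l) :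
    signExpect (fun e : Fin m → Bool => ⨆ t, |∑ i, sgn (e i) * v t i|) ≤ L / l + l * s / 2 := by
  classical
  set J : Finset (Fin m → ℝ) := Finset.univ.image v with hJ
  have hJN : (J.card : ℝ) ≤ N := by
    rw [← Set.ncard_coe_finset]
    simpa [hJ] using hN
  have hNpos : 0 < N := by
    refine lt_of_lt_of_le ?_ hJN
    exact_mod_cast Finset.card_pos.mpr ((Finset.univ_nonempty).image v)
  set E := signExpect (fun e : Fin m → Bool => ⨆ t, |∑ i, sgn (e i) * v t i|) with hE
  -- The exponential of a maximum is at most the sum of the exponentials. Both signs of each vector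
  -- are included because of the absolute value, hence `2 * N`.
  have hsup : ∀ e : Fin m → Bool, Real.exp (l * ⨆ t, |∑ i, sgn (e i) * v t i|) ≤
      ∑ x ∈ J, (Real.exp (∑ i, sgn (e i) * (l * x i)) + Real.exp (∑ i, sgn (e i) * (-l * x i))) := by
    intro e
    obtain ⟨t, ht⟩ := exists_eq_ciSup_of_finite (f := fun t => |∑ i, sgn (e i) * v t i|)
    rw [← ht]
    have hmem : v t ∈ J := Finset.mem_image_of_mem v (Finset.mem_univ t)
    have hle := Finset.single_le_sum (s := J) (a := v t)
      (f := fun x => Real.exp (∑ i, sgn (e i) * (l * x i)) + Real.exp (∑ i, sgn (e i) * (-l * x i)))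
      (fun x _ => (add_pos (Real.exp_pos _) (Real.exp_pos _)).le) hmem
    refine le_trans ?_ hle
    clear hle hmem
    have a1 : ∑ i, sgn (e i) * (l * v t i) = l * ∑ i, sgn (e i) * v t i := by
      rw [Finset.mul_sum]; exact Finset.sum_congr rfl fun i _ => by ring
    have a2 : ∑ i, sgn (e i) * (-l * v t i) = l * -∑ i, sgn (e i) * v t i := by
      rw [← Finset.sum_neg_distrib, Finset.mul_sum]; exact Finset.sum_congr rfl fun i _ => by ring
    simp only [a1, a2]
    rcases abs_cases (∑ i, sgn (e i) * v t i) with ⟨h, _⟩ | ⟨h, _⟩ <;> rw [h]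
    · linarith [Real.exp_pos (l * -∑ i, sgn (e i) * v t i)]
    · linarith [Real.exp_pos (l * ∑ i, sgn (e i) * v t i)]
  have hexp : Real.exp (l * E) ≤ 2 * N * Real.exp (l ^ 2 * s / 2) := by
    have h1 : Real.exp (l * E) ≤ signExpect (fun e : Fin m → Bool =>
        Real.exp (l * ⨆ t, |∑ i, sgn (e i) * v t i|)) := by
      rw [hE]
      unfold signExpect
      rw [← expect_const_mul]
      exact exp_expect_le half_nonneg sum_half _
    refine h1.trans ((expect_mono half_nonneg hsup).trans ?_)
    rw [expect_sum]
    have hx : ∀ x ∈ J, ∀ c : ℝ, c ^ 2 = l ^ 2 → signExpect (fun e : Fin m → Bool =>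
        Real.exp (∑ i, sgn (e i) * (c * x i))) ≤ Real.exp (l ^ 2 * s / 2) := by
      intro x hx c hc
      refine (signExpect_exp fun i => c * x i).trans (Real.exp_le_exp.mpr ?_)
      obtain ⟨t, _, rfl⟩ := Finset.mem_image.mp hx
      simp only [mul_pow, ← Finset.mul_sum, hc]
      have := mul_le_mul_of_nonneg_left (hs t) (sq_nonneg l)
      linarith
    have hterm : ∀ x ∈ J, expect (fun _ => 1 / 2) (fun e : Fin m → Bool =>
        Real.exp (∑ i, sgn (e i) * (l * x i)) + Real.exp (∑ i, sgn (e i) * (-l * x i))) ≤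
        2 * Real.exp (l ^ 2 * s / 2) := by
      intro x hxJ
      rw [expect_add]
      have b1 := hx x hxJ l rfl
      have b2 := hx x hxJ (-l) (by ring)
      unfold signExpect at b1 b2
      linarith
    refine (Finset.sum_le_sum hterm).trans ?_
    rw [Finset.sum_const, nsmul_eq_mul]
    have := Real.exp_pos (l ^ 2 * s / 2)
    nlinarith
  have h2 : l * E ≤ Real.log (2 * N) + l ^ 2 * s / 2 := by
    rw [← Real.exp_le_exp, Real.exp_add, Real.exp_log (by positivity)]
    exact hexp
  have h3 : E ≤ (L + l ^ 2 * s / 2) / l := by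
    rw [le_div_iff₀ hl]
    linarith
  refine h3.trans (le_of_eq ?_)
  field_simp

/-- The parameter √(2L/s) balances the two terms of `massart`. The version with a free parameter
remains useful when s is random, because a fixed parameter keeps the bound linear in s. -/
theorem massart_sqrt {ι : Type*} [Fintype ι] [Nonempty ι] (v : ι → Fin m → ℝ) (s L : ℝ)
    (hs : ∀ t, ∑ i, v t i ^ 2 ≤ s) (N : ℝ) (hsp : 0 < s) (hLp : 0 < L)
    (hN : ((Set.range v).ncard : ℝ) ≤ N) (hL : Real.log (2 * N) ≤ L) :
    signExpect (fun e : Fin m → Bool => ⨆ t, |∑ i, sgn (e i) * v t i|) ≤ √(2 * L * s) := by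
  refine (massart v s L hs N hN hL (√(2 * L / s)) (by positivity)).trans (le_of_eq ?_)
  have h1 : √(2 * L * s) = √(2 * L / s) * s := by
    rw [show 2 * L * s = (2 * L / s) * s ^ 2 by field_simp, Real.sqrt_mul (by positivity),
      Real.sqrt_sq hsp.le]
  rw [h1]
  have h2 : √(2 * L / s) ^ 2 = 2 * L / s := Real.sq_sqrt (by positivity)
  have h3 : 0 < √(2 * L / s) := by positivity
  have h4 : L / √(2 * L / s) = √(2 * L / s) * s / 2 := by
    rw [div_eq_iff h3.ne']
    have : √(2 * L / s) * s / 2 * √(2 * L / s) = √(2 * L / s) ^ 2 * s / 2 := by ring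
    rw [this, h2]
    field_simp
  rw [h4]
  ring

/-- Chaining along nets of size `exp (4 ^ h * Λ)` at scale `2 ^ (-h)`. -/
theorem chaining {ι : Type*} [Fintype ι] [Nonempty ι] (v : ι → Fin m → ℝ) (b Λ : ℝ) (hb : 0 < b)
    (hm : 0 < m) (hΛ : 1 ≤ Λ) (hv : ∀ t i, |v t i| ≤ b) (H : ℕ)
    (hnet : ∀ h ≤ H, ∃ r : ι → ι, Real.log ((Set.range r).ncard : ℝ) ≤ 4 ^ h * Λ ∧
      ∀ t i, |v t i - v (r t) i| ≤ b / 2 ^ h) :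
    signExpect (fun e : Fin m → Bool => ⨆ t, |∑ i, sgn (e i) * v t i|) ≤
      8 * H * b * √(m * Λ) + b * m / 2 ^ H := by
  classical
  have hnet' : ∀ h, ∃ r : ι → ι, h ≤ H → Real.log ((Set.range r).ncard : ℝ) ≤ 4 ^ h * Λ ∧
      ∀ t i, |v t i - v (r t) i| ≤ b / 2 ^ h := fun h => by
    by_cases hh : h ≤ H
    · obtain ⟨r, hr⟩ := hnet h hh
      exact ⟨r, fun _ => hr⟩
    · exact ⟨id, fun hh' => absurd hh' hh⟩
  choose r hr using hnet'
  -- At level 0 the vector 0 serves as approximation, which is admissible because |v t i| ≤ b; the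
  -- telescoping sum then has no initial term.
  let G : ℕ → ι → Fin m → ℝ := fun h t => if h = 0 then 0 else v (r h t)
  have hG : ∀ h ≤ H, ∀ t i, |v t i - G h t i| ≤ b / 2 ^ h := by
    intro h hH t i
    by_cases h0 : h = 0
    · subst h0; simpa [G] using hv t i
    · simpa [G, h0] using (hr h hH).2 t i
  have hGN : ∀ h ≤ H, 1 ≤ (Set.range (G h)).ncard ∧
      Real.log ((Set.range (G h)).ncard : ℝ) ≤ 4 ^ h * Λ := by
    intro h hH
    have hpos : 1 ≤ (Set.range (G h)).ncard :=
      (Set.ncard_pos (Set.toFinite _)).mpr (Set.range_nonempty _)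
    refine ⟨hpos, ?_⟩
    by_cases h0 : h = 0
    · subst h0
      have : Set.range (G 0) = {0} := by
        ext x; simp [G]
      rw [this]; simp; linarith
    · refine le_trans ?_ (hr h hH).1
      have hsub : Set.range (G h) = v '' Set.range (r h) := by
        rw [← Set.range_comp]; congr 1; funext t; simp [G, h0]
      refine Real.log_le_log (by exact_mod_cast hpos) ?_
      rw [hsub]
      exact_mod_cast Set.ncard_image_le (Set.toFinite _)
  have hmR : (0 : ℝ) < m := by exact_mod_cast hm
  -- Increments have entries at most 3b/(2 * 2^h) and take at most exp (5 * 4^h * Λ) values. The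
  -- powers of 2 and 4 cancel in `massart_sqrt`, so every level costs the same.
  have hstep : ∀ h < H, signExpect (fun e : Fin m → Bool =>
      ⨆ t, |∑ i, sgn (e i) * (G (h + 1) t i - G h t i)|) ≤ 8 * b * √(m * Λ) := by
    intro h hH
    have h4 : (1 : ℝ) ≤ 4 ^ h := one_le_pow₀ (by norm_num)
    have hcard : ((Set.range fun t => fun i => G (h + 1) t i - G h t i).ncard : ℝ) ≤
        ((Set.range (G (h + 1))).ncard : ℝ) * ((Set.range (G h)).ncard : ℝ) := by
      rw [← Nat.cast_mul, ← Set.ncard_prod]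
      have : (Set.range fun t => fun i => G (h + 1) t i - G h t i) ⊆
          (fun z : (Fin m → ℝ) × (Fin m → ℝ) => z.1 - z.2) ''
            (Set.range (G (h + 1)) ×ˢ Set.range (G h)) := by
        rintro _ ⟨t, rfl⟩
        exact ⟨(G (h + 1) t, G h t), ⟨⟨t, rfl⟩, ⟨t, rfl⟩⟩, rfl⟩
      exact_mod_cast (Set.ncard_le_ncard this (Set.toFinite _)).trans
        (Set.ncard_image_le (Set.toFinite _))
    have hlog : Real.log (2 * (((Set.range (G (h + 1))).ncard : ℝ) * ((Set.range (G h)).ncard : ℝ)))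
        ≤ 6 * 4 ^ h * Λ := by
      obtain ⟨p1, l1⟩ := hGN (h + 1) hH
      obtain ⟨p2, l2⟩ := hGN h hH.le
      have p1' : (0 : ℝ) < (Set.range (G (h + 1))).ncard := by exact_mod_cast p1
      have p2' : (0 : ℝ) < (Set.range (G h)).ncard := by exact_mod_cast p2
      rw [Real.log_mul (by norm_num) (by positivity), Real.log_mul p1'.ne' p2'.ne']
      have := Real.log_two_lt_d9
      rw [pow_succ] at l1
      nlinarith
    have hsq : ∀ t, ∑ i, (G (h + 1) t i - G h t i) ^ 2 ≤ m * (3 * b / (2 * 2 ^ h)) ^ 2 := by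
      intro t
      calc ∑ i, (G (h + 1) t i - G h t i) ^ 2 ≤ ∑ _i : Fin m, (3 * b / (2 * 2 ^ h)) ^ 2 := by
            refine Finset.sum_le_sum fun i _ => ?_
            have a1 := abs_le.mp (hG (h + 1) hH t i)
            have a2 := abs_le.mp (hG h hH.le t i)
            have a3 : b / 2 ^ (h + 1) + b / 2 ^ h = 3 * b / (2 * 2 ^ h) := by
              rw [pow_succ]; field_simp; ring
            apply sq_le_sq'
            · linarith [a1.1, a1.2, a2.1, a2.2]
            · linarith [a1.1, a1.2, a2.1, a2.2]
        _ = _ := by simp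
    refine (massart_sqrt (fun t i => G (h + 1) t i - G h t i) _ _ hsq _ (by positivity)
      (by positivity) hcard hlog).trans ?_
    have e8 : (8 : ℝ) * b * √(m * Λ) = √((8 * b) ^ 2 * (m * Λ)) := by
      rw [Real.sqrt_mul (sq_nonneg (8 * b)) (m * Λ), Real.sqrt_sq (by positivity)]
    rw [e8]
    apply Real.sqrt_le_sqrt
    have e1 : ((2 : ℝ) ^ h) ^ 2 = 4 ^ h := by rw [← pow_mul, mul_comm, pow_mul]; norm_num
    have : 2 * (6 * 4 ^ h * Λ) * (m * (3 * b / (2 * 2 ^ h)) ^ 2) = 27 * b ^ 2 * (m * Λ) := by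
      rw [← e1]; field_simp; ring
    rw [this]
    have : 0 ≤ b ^ 2 * (m * Λ) := by positivity
    nlinarith
  have hpt : ∀ e : Fin m → Bool, (⨆ t, |∑ i, sgn (e i) * v t i|) ≤
      (∑ h ∈ Finset.range H, ⨆ t, |∑ i, sgn (e i) * (G (h + 1) t i - G h t i)|) + b * m / 2 ^ H := by
    intro e
    refine ciSup_le fun t => ?_
    have e1 : ∑ i, sgn (e i) * v t i =
        (∑ h ∈ Finset.range H, ∑ i, sgn (e i) * (G (h + 1) t i - G h t i)) +
          ∑ i, sgn (e i) * (v t i - G H t i) := by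
      rw [Finset.sum_comm, ← Finset.sum_add_distrib]
      refine Finset.sum_congr rfl fun i _ => ?_
      rw [← Finset.mul_sum, Finset.sum_range_sub (fun h => G h t i)]
      simp [G]
      ring
    rw [e1]
    refine (abs_add_le _ _).trans (add_le_add ?_ ?_)
    · refine (Finset.abs_sum_le_sum_abs _ _).trans (Finset.sum_le_sum fun h _ => ?_)
      exact abs_sum_le_iSup (fun t => ∑ i, sgn (e i) * (G (h + 1) t i - G h t i)) t
    · refine (Finset.abs_sum_le_sum_abs _ _).trans ?_
      calc ∑ i, |sgn (e i) * (v t i - G H t i)| ≤ ∑ _i : Fin m, b / 2 ^ H := by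
            refine Finset.sum_le_sum fun i _ => ?_
            rw [abs_mul, abs_sgn, one_mul]
            exact hG H le_rfl t i
        _ = _ := by simp; ring
  refine (expect_mono half_nonneg hpt).trans ?_
  rw [expect_add, expect_const sum_half, expect_sum]
  have : ∑ h ∈ Finset.range H, expect (fun _ => 1 / 2) (fun e : Fin m → Bool =>
      ⨆ t, |∑ i, sgn (e i) * (G (h + 1) t i - G h t i)|) ≤ ∑ _h ∈ Finset.range H, 8 * b * √(m * Λ) :=
    Finset.sum_le_sum fun h hh => hstep h (Finset.mem_range.mp hh)
  rw [Finset.sum_const, Finset.card_range, nsmul_eq_mul] at this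
  linarith

end Expectation

/-! ### Stability bounds the number of ambiguous clusters. -/

section Geometry

variable {d k : ℕ}

theorem ptCost_le (p : Pt d) (S : Fin k → Pt d) (i : Fin k) : ptCost p S ≤ dist p (S i) :=
  ciInf_le ⟨0, by rintro _ ⟨i, rfl⟩; exact dist_nonneg⟩ i

theorem exists_ptCost_eq [NeZero k] (p : Pt d) (S : Fin k → Pt d) :
    ∃ i, ptCost p S = dist p (S i) := by
  obtain ⟨i, hi⟩ := exists_eq_ciInf_of_finite (f := fun i => dist p (S i))
  exact ⟨i, hi.symm⟩

theorem ptCost_le_add [NeZero k] (p q : Pt d) (S : Fin k → Pt d) :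
    ptCost p S ≤ dist p q + ptCost q S := by
  obtain ⟨i, hi⟩ := exists_ptCost_eq q S
  rw [hi]
  exact (ptCost_le p S i).trans (dist_triangle _ _ _)

theorem opt_le_cost (P : Finset (Pt d)) (S : Fin k → Pt d) : opt P k ≤ cost P S :=
  ciInf_le ⟨0, by rintro _ ⟨i, rfl⟩; exact cost_nonneg _ _⟩ S

theorem opt_nonneg (P : Finset (Pt d)) (k : ℕ) : 0 ≤ opt P k :=
  Real.iInf_nonneg fun _ => cost_nonneg _ _

theorem ptCost_eq_of_isNearest {P : Finset (Pt d)} {A : Fin k → Pt d} {σ : Pt d → Fin k}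
    (h : IsNearest P A σ) {p : Pt d} (hp : p ∈ P) : ptCost p A = dist p (A (σ p)) := by
  have : Nonempty (Fin k) := ⟨σ p⟩
  exact le_antisymm (ptCost_le _ _ _) (le_ciInf fun i => h p hp i)

/-- In a stable instance, a solution that uses only the centers in `D` is expensive. -/
theorem mul_opt_le_of_isStable {P : Finset (Pt d)} {β : ℝ} (hk : 2 ≤ k)
    (hst : IsStable P k β) (S : Fin k → Pt d) (D : Finset (Fin k)) (hD : D.card < k)
    (f : Pt d → Fin k) (hf : ∀ p ∈ P, f p ∈ D) :
    ((k : ℝ) - D.card) * (β * opt P k) ≤ 2 * ∑ p ∈ P, dist p (S (f p)) := by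
  classical
  obtain ⟨n, rfl⟩ : ∃ n, k = n + 1 := ⟨k - 1, by omega⟩
  have hn : 1 ≤ n := by omega
  have hst' : opt P (n + 1) * (1 + β) ≤ opt P n := by simpa using hst hk
  set C := ∑ p ∈ P, dist p (S (f p)) with hC
  have hC0 : 0 ≤ C := Finset.sum_nonneg fun _ _ => dist_nonneg
  set l : ℝ := ((n + 1 : ℕ) : ℝ) - D.card with hl
  have hlpos : 0 < l := by
    have : (D.card : ℝ) < ((n + 1 : ℕ) : ℝ) := by exact_mod_cast hD
    linarith
  -- An arbitrary B is compared, not an optimal one, so that the infimum need not be attained.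
  have key : ∀ B : Fin (n + 1) → Pt d, opt P (n + 1) * (1 + β) - 2 * C / l ≤ cost P B := by
    intro B
    have hπ : ∀ x : Pt d, ∃ i, ∀ j, dist x (B i) ≤ dist x (B j) := by
      intro x
      obtain ⟨i, hi⟩ := exists_ptCost_eq x B
      exact ⟨i, fun j => hi ▸ ptCost_le x B j⟩
    choose π hπ using hπ
    -- The centers of B that are not chosen as nearest to any `S s` with s in D. Any of them can be
    -- deleted: its points p are rerouted through `S (f p)` to the center of B nearest to that, at
    -- an extra cost of at most 2 * dist p (S (f p)).
    set U : Finset (Fin (n + 1)) := Finset.univ \ D.image (fun s => π (S s)) with hU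
    have hUcard : l ≤ U.card := by
      have h1 : n + 1 ≤ U.card + D.card := by
        have h2 := Finset.card_image_le (s := D) (f := fun s => π (S s))
        have h3 := Finset.le_card_sdiff (D.image fun s => π (S s)) Finset.univ
        rw [Finset.card_univ, Fintype.card_fin, ← hU] at h3
        omega
      have : ((n + 1 : ℕ) : ℝ) ≤ U.card + D.card := by exact_mod_cast h1
      linarith
    have hdel : ∀ i ∈ U, opt P n ≤ cost P B + ∑ p ∈ P with π p = i, 2 * dist p (S (f p)) := by
      intro i hi
      refine (opt_le_cost P (fun j => B (i.succAbove j))).trans ?_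
      unfold cost
      rw [Finset.sum_filter, ← Finset.sum_add_distrib]
      refine Finset.sum_le_sum fun p hp => ?_
      have hp' : ptCost p B = dist p (B (π p)) :=
        le_antisymm (ptCost_le _ _ _) (le_ciInf fun j => hπ p j)
      split_ifs with h
      · have hne : π (S (f p)) ≠ i := by
          rintro rfl
          simp only [hU, Finset.mem_sdiff, Finset.mem_univ, true_and, Finset.mem_image,
            not_exists, not_and] at hi
          exact hi _ (hf p hp) rfl
        obtain ⟨j, hj⟩ := Fin.exists_succAbove_eq hne
        refine (ptCost_le p _ j).trans ?_
        rw [hj]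
        have h1 := dist_triangle p (S (f p)) (B (π (S (f p))))
        have h2 := hπ (S (f p)) (π p)
        have h3 := dist_triangle (S (f p)) p (B (π p))
        rw [dist_comm (S (f p)) p] at h3
        linarith
      · obtain ⟨j, hj⟩ := Fin.exists_succAbove_eq h
        refine (ptCost_le p _ j).trans ?_
        rw [hj, hp', add_zero]
    -- Averaging over the deletions: the rerouted groups are disjoint, so the extra costs add up to
    -- at most 2C. This produces the factor k - |D|.
    have hsum : (U.card : ℝ) * opt P n ≤ U.card * cost P B + 2 * C := by
      have h1 := Finset.sum_le_sum hdel
      rw [Finset.sum_add_distrib, Finset.sum_const, Finset.sum_const, nsmul_eq_mul,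
        nsmul_eq_mul] at h1
      refine h1.trans (add_le_add le_rfl ?_)
      rw [hC, Finset.mul_sum]
      calc ∑ i ∈ U, ∑ p ∈ P with π p = i, 2 * dist p (S (f p))
          ≤ ∑ i, ∑ p ∈ P with π p = i, 2 * dist p (S (f p)) :=
            Finset.sum_le_univ_sum_of_nonneg fun i =>
              Finset.sum_nonneg fun p _ => by positivity
        _ = _ := Finset.sum_fiberwise _ _ _
    rcases le_total (opt P n) (cost P B) with h | h
    · have : 0 ≤ 2 * C / l := by positivity
      linarith
    · have h1 : l * (opt P n - cost P B) ≤ 2 * C := by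
        have := mul_le_mul_of_nonneg_right hUcard (sub_nonneg.mpr h)
        linarith
      have h2 : opt P n - cost P B ≤ 2 * C / l := by
        rw [le_div_iff₀ hlpos]; linarith
      linarith
  have := le_ciInf key
  change _ ≤ opt P (n + 1) at this
  have h2 : β * opt P (n + 1) ≤ 2 * C / l := by linarith
  rw [le_div_iff₀ hlpos] at h2
  linarith

/-- A family of `k` non-empty subsets of a `k`-element set, `x` of which have at least two elements,
has a transversal of size at most `k - x / 4`. -/
theorem exists_transversal (N : Fin k → Finset (Fin k)) (hN : ∀ j, (N j).Nonempty) :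
    ∃ D : Finset (Fin k), (∀ j, ∃ s ∈ N j, s ∈ D) ∧
      4 * D.card + (Finset.univ.filter fun j => 2 ≤ (N j).card).card ≤ 4 * k := by
  classical
  set X := Finset.univ.filter fun j => 2 ≤ (N j).card with hX
  choose f hf using hN
  let u : Finset (Fin k) → Finset (Fin k) := fun B => Finset.univ.filter fun j => Disjoint (N j) B
  -- Averaging over a uniformly random B: its mean size is k/2, and N j is missed with probability
  -- 2^(-|N j|), which is at most 1/2, and at most 1/4 for j in X. One representative per missed set
  -- is added, so the mean total is at most k/2 + (k - |X|)/2 + |X|/4 = k - |X|/4.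
  have key : ∃ B : Finset (Fin k), 4 * (B.card + (u B).card) + X.card ≤ 4 * k := by
    by_contra! hcon
    have hlt : ∑ B : Finset (Fin k), 4 * k < ∑ B : Finset (Fin k),
        (4 * (B.card + (u B).card) + X.card) :=
      Finset.sum_lt_sum_of_nonempty Finset.univ_nonempty fun B _ => hcon B
    have h1 : ∑ B : Finset (Fin k), 2 * B.card = 2 ^ k * k := by
      have e : ∑ B : Finset (Fin k), B.card = ∑ B : Finset (Fin k), Bᶜ.card :=
        (Equiv.sum_comp (Function.Involutive.toPerm (fun B : Finset (Fin k) => Bᶜ)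
          compl_involutive) (fun B => B.card)).symm
      have e2 : ∑ B : Finset (Fin k), (B.card + Bᶜ.card) = 2 ^ k * k := by
        simp [Finset.card_add_card_compl]
      rw [Finset.sum_add_distrib, ← e] at e2
      rw [← Finset.mul_sum]
      omega
    have h2 : ∑ B : Finset (Fin k), (u B).card = ∑ j, 2 ^ (k - (N j).card) := by
      simp only [u, Finset.card_filter]
      rw [Finset.sum_comm]
      refine Finset.sum_congr rfl fun j _ => ?_
      rw [← Finset.card_filter]
      have : (Finset.univ.filter fun B : Finset (Fin k) => Disjoint (N j) B) = (N j)ᶜ.powerset := by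
        ext B
        simp [Finset.subset_compl_iff_disjoint_left]
      rw [this, Finset.card_powerset, Finset.card_compl, Fintype.card_fin]
    have h3 : ∀ j, 4 * 2 ^ (k - (N j).card) + (if j ∈ X then 2 ^ k else 0) ≤ 2 * 2 ^ k := by
      intro j
      have hle : (N j).card ≤ k := by simpa using Finset.card_le_univ (N j)
      have hpos : 1 ≤ (N j).card := Finset.card_pos.mpr ⟨f j, hf j⟩
      split_ifs with h
      · have h2 : 2 ≤ (N j).card := by simpa [hX] using h
        have : 2 ^ (k - (N j).card) ≤ 2 ^ (k - 2) := Nat.pow_le_pow_right (by norm_num) (by omega)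
        have e : 2 ^ k = 4 * 2 ^ (k - 2) := by
          conv_lhs => rw [show k = (k - 2) + 2 by omega, pow_add]
          ring
        omega
      · have : 2 ^ (k - (N j).card) ≤ 2 ^ (k - 1) := Nat.pow_le_pow_right (by norm_num) (by omega)
        have e : 2 ^ k = 2 * 2 ^ (k - 1) := by
          conv_lhs => rw [show k = (k - 1) + 1 by omega, pow_add]
          ring
        omega
    have h4 := Finset.sum_le_sum fun j (_ : j ∈ Finset.univ) => h3 j
    rw [Finset.sum_add_distrib, ← Finset.mul_sum, ← Finset.sum_filter, Finset.sum_const,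
      Finset.sum_const, Finset.filter_mem_eq_inter, Finset.univ_inter, Finset.card_univ,
      Fintype.card_fin] at h4
    simp only [mul_add, Finset.sum_add_distrib, Finset.sum_const, Finset.card_univ,
      Fintype.card_finset, Fintype.card_fin, smul_eq_mul] at hlt h4
    rw [← Finset.mul_sum] at h1
    simp only [← Finset.mul_sum] at hlt
    rw [h2] at hlt
    have h5 : k * (2 * 2 ^ k) = 2 * (2 ^ k * k) := by ring
    have h6 : 2 ^ k * (4 * k) = 4 * (2 ^ k * k) := by ring
    have h7 : X.card * 2 ^ k = 2 ^ k * X.card := by ring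
    omega
  obtain ⟨B, hB⟩ := key
  refine ⟨B ∪ (u B).image f, fun j => ?_, ?_⟩
  · by_cases h : Disjoint (N j) B
    · exact ⟨f j, hf j, Finset.mem_union_right _ (Finset.mem_image_of_mem f (by simp [u, h]))⟩
    · obtain ⟨s, h1, h2⟩ := Finset.not_disjoint_iff.mp h
      exact ⟨s, h1, Finset.mem_union_left _ h2⟩
  · have h1 := Finset.card_union_le B ((u B).image f)
    have h2 := Finset.card_image_le (s := u B) (f := f)
    omega

/-- The centers of `S` that are, up to a factor of `3`, nearest to `a`. -/
noncomputable def nearCenters (S : Fin k → Pt d) (a : Pt d) : Finset (Fin k) :=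
  Finset.univ.filter fun s => dist a (S s) ≤ 3 * ptCost a S

/-- The clusters whose center has several near centers in `S`. -/
noncomputable def ambiguous (A S : Fin k → Pt d) : Finset (Fin k) :=
  Finset.univ.filter fun j => 2 ≤ (nearCenters S (A j)).card

/-- Sending each point to a near center of its own center of A costs at most 3 cost(P, S) + 4
cost(P, A). A transversal of the near sets achieves this while saving at least a quarter as many
centers as there are ambiguous clusters, and stability makes each saved center costly. -/
theorem card_ambiguous_mul_opt_le {P : Finset (Pt d)} {β : ℝ} (hst : IsStable P k β)
    {A : Fin k → Pt d} {σ : Pt d → Fin k} (hσ : IsNearest P A σ) (S : Fin k → Pt d) :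
    ((ambiguous A S).card : ℝ) * (β * opt P k) ≤ 8 * (3 * cost P S + 4 * cost P A) := by
  classical
  rcases Nat.eq_zero_or_pos (ambiguous A S).card with h0 | hpos
  · have := cost_nonneg P S
    have := cost_nonneg P A
    rw [h0]; simp only [Nat.cast_zero, zero_mul]; positivity
  have hk : 2 ≤ k := by
    obtain ⟨j, hj⟩ := Finset.card_pos.mp hpos
    have h2 : 2 ≤ (nearCenters S (A j)).card := by simpa [ambiguous] using hj
    exact h2.trans (by simpa using Finset.card_le_univ (nearCenters S (A j)))
  have : NeZero k := ⟨by omega⟩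
  obtain ⟨D, hD, hcard⟩ := exists_transversal (fun j => nearCenters S (A j)) fun j => by
    obtain ⟨i, hi⟩ := exists_ptCost_eq (A j) S
    refine ⟨i, ?_⟩
    have := ptCost_nonneg (A j) S
    simp only [nearCenters, Finset.mem_filter, Finset.mem_univ, true_and]
    linarith
  change 4 * D.card + (ambiguous A S).card ≤ 4 * k at hcard
  choose g hg hgD using hD
  have hDk : D.card < k := by omega
  have h1 := mul_opt_le_of_isStable hk hst S D hDk (fun p => g (σ p)) fun p _ => hgD _
  have h2 : ∑ p ∈ P, dist p (S (g (σ p))) ≤ 3 * cost P S + 4 * cost P A := by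
    unfold cost
    rw [Finset.mul_sum, Finset.mul_sum, ← Finset.sum_add_distrib]
    refine Finset.sum_le_sum fun p hp => ?_
    have e1 := ptCost_eq_of_isNearest hσ hp
    have e2 : dist (A (σ p)) (S (g (σ p))) ≤ 3 * ptCost (A (σ p)) S := by
      simpa [nearCenters] using hg (σ p)
    have e3 := ptCost_le_add (A (σ p)) p S
    have e4 := dist_triangle p (A (σ p)) (S (g (σ p)))
    rw [dist_comm] at e3
    linarith
  have hc : (4 * D.card + (ambiguous A S).card : ℝ) ≤ 4 * k := by exact_mod_cast hcard
  rcases le_or_gt 0 (β * opt P k) with hb | hb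
  · have h3 : ((ambiguous A S).card : ℝ) * (β * opt P k) ≤
        4 * (((k : ℝ) - D.card) * (β * opt P k)) := by nlinarith
    linarith
  · have := cost_nonneg P S
    have := cost_nonneg P A
    have h4 : ((ambiguous A S).card : ℝ) * (β * opt P k) ≤ 0 :=
      mul_nonpos_of_nonneg_of_nonpos (Nat.cast_nonneg _) hb.le
    nlinarith

end Geometry

/-! ### Dimension-free codes for directions, radii and distances. -/

section Codes

variable {E : Type*} [NormedAddCommGroup E] [InnerProductSpace ℝ E]

/-- Greedy pursuit: while some |⟨e l, v⟩| exceeds δ, subtracting ±δ • e l lowers ‖v‖² by at least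
δ², so n steps suffice. The value 0 at the all-`none` word allows an early stop. -/
theorem exists_greedy {ι : Type*} (e : ι → E) (he : ∀ l, ‖e l‖ ≤ 1) {δ : ℝ} (hδ : 0 < δ) (n : ℕ) :
    ∃ w : (Fin n → Option (Bool × ι)) → E, w (fun _ => none) = 0 ∧
      ∀ v : E, ‖v‖ ^ 2 ≤ n * δ ^ 2 → ∃ c, ∀ l, |inner ℝ (e l) (v - w c)| ≤ δ := by
  induction n with
  | zero =>
    refine ⟨fun _ => 0, rfl, fun v hv => ⟨fun i => i.elim0, fun l => ?_⟩⟩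
    have : v = 0 := by
      have h : ‖v‖ ^ 2 ≤ 0 := by simpa using hv
      simpa using le_antisymm h (sq_nonneg _)
    simp [this, hδ.le]
  | succ n ih =>
    obtain ⟨w, hw0, hw⟩ := ih
    refine ⟨fun c => w (fun i => c i.succ) +
      match c 0 with
      | none => 0
      | some z => (δ * sgn z.1) • e z.2, by simp [hw0], fun v hv => ?_⟩
    have step : ∃ o : Option (Bool × ι), ‖v - (match o with
        | none => 0
        | some z => (δ * sgn z.1) • e z.2)‖ ^ 2 ≤ n * δ ^ 2 ∨
        (o = none ∧ ∀ l, |inner ℝ (e l) v| ≤ δ) := by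
      by_cases hall : ∀ l, |inner ℝ (e l) v| ≤ δ
      · exact ⟨none, Or.inr ⟨rfl, hall⟩⟩
      · push Not at hall
        obtain ⟨l, hl⟩ := hall
        have main : ∀ b : Bool, |inner ℝ (e l) v| = sgn b * inner ℝ (e l) v →
            ‖v - (δ * sgn b) • e l‖ ^ 2 ≤ n * δ ^ 2 := by
          intro b hb
          rw [norm_sub_sq_real, norm_smul, inner_smul_right, real_inner_comm, mul_pow, Real.norm_eq_abs,
            sq_abs]
          have hs : sgn b ^ 2 = 1 := by cases b <;> simp [sgn]
          have h1 : ‖e l‖ ^ 2 ≤ 1 := pow_le_one₀ (norm_nonneg _) (he l)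
          have h2 : δ * |inner ℝ (e l) v| > δ * δ := mul_lt_mul_of_pos_left hl hδ
          rw [hb] at h2
          push_cast at hv
          have h3 : (δ * sgn b) ^ 2 * ‖e l‖ ^ 2 ≤ δ ^ 2 := by
            rw [mul_pow, hs, mul_one]
            exact mul_le_of_le_one_right (sq_nonneg _) h1
          nlinarith
        rcases abs_cases (inner ℝ (e l) v) with ⟨h, _⟩ | ⟨h, _⟩
        · exact ⟨some (true, l), Or.inl (main true (by rw [h]; simp [sgn]))⟩
        · exact ⟨some (false, l), Or.inl (main false (by rw [h]; simp [sgn]))⟩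
    obtain ⟨o, ho | ⟨rfl, ho⟩⟩ := step
    · obtain ⟨c, hc⟩ := hw _ ho
      refine ⟨Fin.cons o c, fun l => ?_⟩
      have := hc l
      simp only [Fin.cons_succ, Fin.cons_zero]
      rwa [add_comm, ← sub_sub]
    · exact ⟨fun _ => none, fun l => by simpa [hw0] using ho l⟩

/-- A code with `(2 |ι| + 1) ^ n` values for directions, accurate on the vectors `y l`. -/
theorem exists_direction_code {ι : Type*} (y : ι → E) {δ : ℝ} (hδ : 0 < δ) {n : ℕ}
    (hn : 1 ≤ n * δ ^ 2) :
    ∃ κ : E → (Fin n → Option (Bool × ι)), ∀ v v', κ v = κ v' →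
      ∀ l, |inner ℝ (y l) (‖v‖⁻¹ • v - ‖v'‖⁻¹ • v')| ≤ 2 * δ * ‖y l‖ := by
  have hunit : ∀ v : E, ‖‖v‖⁻¹ • v‖ ≤ 1 := by
    intro v
    rw [norm_smul, norm_inv, norm_norm]
    exact inv_mul_le_one
  obtain ⟨w, -, hw⟩ := exists_greedy (fun l => ‖y l‖⁻¹ • y l) (fun l => hunit _) hδ n
  have hv : ∀ v : E, ∃ c, ∀ l, |inner ℝ (‖y l‖⁻¹ • y l) (‖v‖⁻¹ • v - w c)| ≤ δ := fun v =>
    hw _ ((pow_le_one₀ (norm_nonneg _) (hunit v)).trans hn)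
  choose κ hκ using hv
  refine ⟨κ, fun v v' h l => ?_⟩
  have h1 := hκ v l
  have h2 := hκ v' l
  rw [← h] at h2
  rcases eq_or_ne (y l) 0 with h0 | h0
  · simp [h0]
  have hpos : 0 < ‖y l‖ := norm_pos_iff.mpr h0
  have h3 : |inner ℝ (‖y l‖⁻¹ • y l) (‖v‖⁻¹ • v - ‖v'‖⁻¹ • v')| ≤ 2 * δ := by
    have e : ‖v‖⁻¹ • v - ‖v'‖⁻¹ • v' = (‖v‖⁻¹ • v - w (κ v)) - (‖v'‖⁻¹ • v' - w (κ v)) := by abel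
    rw [e, inner_sub_right]
    exact (abs_sub _ _).trans (by linarith)
  rw [real_inner_smul_left, abs_mul, abs_of_pos (inv_pos.mpr hpos), inv_mul_le_iff₀ hpos] at h3
  linarith

/-- A code with `m * T + 1` values for non-negative reals, with additive accuracy `δ * ρ i` below
`T * δ * ρ i`. -/
theorem exists_threshold_code {m : ℕ} (ρ : Fin m → ℝ) (hρ : ∀ i, 0 ≤ ρ i) {δ : ℝ} (hδ : 0 < δ)
    (T : ℕ) :
    ∃ τ : ℝ → Fin (m * T + 1), ∀ y y', 0 ≤ y → 0 ≤ y' → τ y = τ y' →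
      ∀ i, |y - y'| ≤ δ * ρ i ∨ (T * (δ * ρ i) ≤ y ∧ T * (δ * ρ i) ≤ y') := by
  classical
  -- The sets Θ y increase with y, so their cardinality alone determines them; this leaves only m *
  -- T + 1 codes.
  let Θ : ℝ → Finset (Fin m × Fin T) := fun y =>
    Finset.univ.filter fun z => ((z.2 : ℕ) + 1 : ℝ) * (δ * ρ z.1) ≤ y
  have hΘ : ∀ y, (Θ y).card < m * T + 1 := fun y => by
    have := Finset.card_le_univ (Θ y)
    simp only [Fintype.card_prod, Fintype.card_fin] at this
    omega
  have hmono : ∀ y y', y ≤ y' → Θ y ⊆ Θ y' := by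
    intro y y' h z hz
    simp only [Θ, Finset.mem_filter, Finset.mem_univ, true_and] at hz ⊢
    exact hz.trans h
  have main : ∀ y y', 0 ≤ y → y ≤ y' → (Θ y).card = (Θ y').card →
      ∀ i, |y - y'| ≤ δ * ρ i ∨ (T * (δ * ρ i) ≤ y ∧ T * (δ * ρ i) ≤ y') := by
    intro y y' h0 hle hcard i
    have heq : Θ y = Θ y' := Finset.eq_of_subset_of_card_le (hmono y y' hle) hcard.ge
    by_cases hT : T * (δ * ρ i) ≤ y
    · exact Or.inr ⟨hT, hT.trans hle⟩
    left
    have hρi : 0 < ρ i := by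
      refine lt_of_le_of_ne (hρ i) fun h => hT ?_
      rw [← h]; simpa using h0
    have hpos : 0 < δ * ρ i := mul_pos hδ hρi
    set t := ⌊y / (δ * ρ i)⌋₊ with ht
    have h1 : (t : ℝ) * (δ * ρ i) ≤ y := by
      rw [← le_div_iff₀ hpos]; exact Nat.floor_le (by positivity)
    have h2 : y < ((t : ℝ) + 1) * (δ * ρ i) := by
      rw [← div_lt_iff₀ hpos]; exact Nat.lt_floor_add_one _
    have htT : t < T := by
      by_contra hcon
      have : (T : ℝ) ≤ t := by exact_mod_cast not_lt.mp hcon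
      exact hT (le_trans (mul_le_mul_of_nonneg_right this hpos.le) h1)
    have h3 : (i, (⟨t, htT⟩ : Fin T)) ∉ Θ y' := by
      rw [← heq]
      simp only [Θ, Finset.mem_filter, Finset.mem_univ, true_and, not_le]
      exact h2
    simp only [Θ, Finset.mem_filter, Finset.mem_univ, true_and, not_le] at h3
    rw [abs_sub_comm, abs_of_nonneg (by linarith)]
    linarith
  refine ⟨fun y => ⟨(Θ y).card, hΘ y⟩, fun y y' h0 h0' h i => ?_⟩
  have hcard : (Θ y).card = (Θ y').card := by simpa using h
  rcases le_total y y' with hle | hle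
  · exact main y y' h0 hle hcard i
  · rw [abs_sub_comm, and_comm]
    exact main y' y h0' hle hcard.symm i

theorem abs_mul_of_nonneg_right {a b : ℝ} (hb : 0 ≤ b) : |a| * b = |a * b| := by
  rw [abs_mul, abs_of_nonneg hb]

theorem norm_smul_inv_smul (v : E) : ‖v‖ • (‖v‖⁻¹ • v) = v := by
  rcases eq_or_ne v 0 with h | h
  · simp [h]
  · rw [smul_smul, mul_inv_cancel₀ (norm_ne_zero_iff.mpr h), one_smul]

/-- A code of a point `s`, from which the distance to each terminal `y l` that is at distance at most
`32 * ρ i` can be recovered up to `135 * δ * ρ i`. -/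
theorem exists_distance_code {ι : Type*} [Finite ι] [Nonempty ι] (y : ι → E) {m : ℕ}
    (ρ : Fin m → ℝ) (hρ : ∀ i, 0 ≤ ρ i) {δ : ℝ} (hδ : 0 < δ) (hδ1 : δ ≤ 1) {n : ℕ}
    (hn : 1 ≤ n * δ ^ 2) {T : ℕ} (hT : 33 ≤ T * δ) :
    ∃ κ : E → ι × Fin (m * T + 1) × (Fin n → Option (Bool × ι)), ∀ s s', κ s = κ s' →
      ∀ l i, 0 < ρ i → dist (y l) s ≤ 32 * ρ i →
        |dist (y l) s - dist (y l) s'| ≤ 135 * δ * ρ i := by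
  obtain ⟨τ, hτ⟩ := exists_threshold_code ρ hρ hδ T
  have hmin : ∀ s : E, ∃ l, ∀ l', dist (y l) s ≤ dist (y l') s := fun s =>
    Finite.exists_min fun l => dist (y l) s
  choose l₀ hl₀ using hmin
  have hdir : ∀ a : ι, ∃ κ : E → (Fin n → Option (Bool × ι)), ∀ v v', κ v = κ v' →
      ∀ l, |inner ℝ (y l - y a) (‖v‖⁻¹ • v - ‖v'‖⁻¹ • v')| ≤ 2 * δ * ‖y l - y a‖ := fun a =>
    exists_direction_code (fun l => y l - y a) hδ hn
  choose G hG using hdir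
  -- Polar coordinates around the terminal nearest to s: the radius is coded by thresholds, the
  -- direction by the greedy code.
  refine ⟨fun s => (l₀ s, τ ‖s - y (l₀ s)‖, G (l₀ s) (s - y (l₀ s))), fun s s' h l i hi hd => ?_⟩
  simp only [Prod.mk.injEq] at h
  obtain ⟨h1, h2, h3⟩ := h
  have hm1 := hl₀ s l
  have hm2 := hl₀ s' l
  rw [← h1] at h2 h3 hm2
  set a := l₀ s
  set v := s - y a with hv
  set v' := s' - y a with hv'
  have hr : dist (y a) s = ‖v‖ := by rw [dist_comm, dist_eq_norm]
  have hr' : dist (y a) s' = ‖v'‖ := by rw [dist_comm, dist_eq_norm]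
  set D := dist (y l) s with hD
  set D' := dist (y l) s' with hD'
  set x := y l - y a with hx
  rw [hr] at hm1
  rw [hr'] at hm2
  -- The saturated branch cannot occur: ‖v‖ ≤ D ≤ 32ρ, whereas saturation would require ‖v‖ ≥ 33ρ.
  have hrr : |‖v‖ - ‖v'‖| ≤ δ * ρ i := by
    rcases hτ _ _ (norm_nonneg v) (norm_nonneg v') h2 i with h | ⟨h, -⟩
    · exact h
    · have : 33 * ρ i ≤ T * δ * ρ i := mul_le_mul_of_nonneg_right hT hi.le
      linarith
  have hDv : D = ‖v - x‖ := by rw [hD, dist_comm, dist_eq_norm, hv, hx]; congr 1; abel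
  have hDv' : D' = ‖v' - x‖ := by rw [hD', dist_comm, dist_eq_norm, hv', hx]; congr 1; abel
  have hx2 : ‖x‖ ≤ D + ‖v‖ := by
    have := norm_sub_le v (v - x)
    rw [sub_sub_cancel, ← hDv] at this
    linarith
  have hx2' : ‖x‖ ≤ D' + ‖v'‖ := by
    have := norm_sub_le v' (v' - x)
    rw [sub_sub_cancel, ← hDv'] at this
    linarith
  have hGx := hG a v v' h3 l
  rw [← hx] at hGx
  clear_value x v v' D D'
  have hin : |inner ℝ x (v - v')| ≤ δ * ρ i * ‖x‖ + ‖v'‖ * (2 * δ * ‖x‖) := by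
    have e : v - v' = (‖v‖ - ‖v'‖) • (‖v‖⁻¹ • v) + ‖v'‖ • (‖v‖⁻¹ • v - ‖v'‖⁻¹ • v') := by
      rw [sub_smul, smul_sub, norm_smul_inv_smul, norm_smul_inv_smul]; abel
    rw [e, inner_add_right, real_inner_smul_right _ _ (‖v‖ - ‖v'‖), real_inner_smul_right _ _ ‖v'‖]
    refine (abs_add_le _ _).trans (add_le_add ?_ ?_)
    · rw [abs_mul]
      refine mul_le_mul hrr ?_ (abs_nonneg _) (by positivity)
      refine (abs_real_inner_le_norm _ _).trans ?_
      have : ‖‖v‖⁻¹ • v‖ ≤ 1 := by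
        rw [norm_smul, norm_inv, norm_norm]
        exact inv_mul_le_one
      exact mul_le_of_le_one_right (norm_nonneg _) this
    · rw [abs_mul, abs_of_nonneg (norm_nonneg v')]
      exact mul_le_mul_of_nonneg_left hGx (norm_nonneg _)
  have hsq : D ^ 2 - D' ^ 2 = (‖v‖ - ‖v'‖) * (‖v‖ + ‖v'‖) - 2 * inner ℝ x (v - v') := by
    rw [hDv, hDv', norm_sub_sq_real, norm_sub_sq_real, inner_sub_right, real_inner_comm v x,
      real_inner_comm v' x]
    ring
  have hv33 : ‖v'‖ ≤ 33 * ρ i := by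
    have := (abs_le.mp hrr).1
    have : δ * ρ i ≤ 1 * ρ i := mul_le_mul_of_nonneg_right hδ1 hi.le
    linarith
  have d1 : 0 ≤ D := hD ▸ dist_nonneg
  have d2 : 0 ≤ D' := hD' ▸ dist_nonneg
  have hDD : 0 ≤ D + D' := add_nonneg d1 d2
  -- Squared distances are compared and D + D' is divided out. As the reference terminal is nearest,
  -- ‖v‖ ≤ D and ‖v'‖ ≤ D', whence ‖x‖ ≤ D + D'. The constant is 1 + 2 * (1 + 2 * 33) = 135.
  have hprod : |D - D'| * (D + D') ≤ 135 * δ * ρ i * (D + D') := by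
    have e : |D - D'| * (D + D') = |D ^ 2 - D' ^ 2| := by
      rw [abs_mul_of_nonneg_right hDD]
      congr 1; ring
    rw [e, hsq]
    have hδρ : 0 ≤ δ * ρ i := by positivity
    have t1 : |(‖v‖ - ‖v'‖) * (‖v‖ + ‖v'‖)| ≤ δ * ρ i * (D + D') := by
      rw [abs_mul, abs_of_nonneg (by positivity : 0 ≤ ‖v‖ + ‖v'‖)]
      exact mul_le_mul hrr (by linarith) (by positivity) hδρ
    have hxD : ‖x‖ ≤ D + D' := by linarith
    have t2 : ‖v'‖ * (2 * δ * ‖x‖) ≤ 33 * ρ i * (2 * δ * (D + D')) := by gcongr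
    have t3 : δ * ρ i * ‖x‖ ≤ δ * ρ i * (D + D') := by gcongr
    refine (abs_sub _ _).trans ?_
    rw [abs_mul (2 : ℝ), abs_two]
    linarith
  rcases hDD.eq_or_lt with h0 | h0
  · have e1 : D = 0 := by linarith
    have e2 : D' = 0 := by linarith
    rw [e1, e2, sub_zero, abs_zero]
    positivity
  · exact le_of_mul_le_mul_right hprod h0

/-- A code of a vector `v`, from which `‖v - z i‖ - ‖v‖` can be recovered up to `6 * δ * ρ i` for all
`i` for which `v` is long compared to `ρ i`. -/
theorem exists_shift_code {m : ℕ} (z : Fin m → E) (ρ : Fin m → ℝ) (hz : ∀ i, ‖z i‖ ≤ ρ i) {δ : ℝ}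
    (hδ : 0 < δ) {n : ℕ} (hn : 1 ≤ n * δ ^ 2) {T : ℕ} (hT : 1 ≤ T * δ ^ 2) :
    ∃ κ : E → Fin (m * T + 1) × (Fin n → Option (Bool × Fin m)), ∀ v v', κ v = κ v' →
      ∀ i, 4 * ρ i < ‖v‖ → 4 * ρ i < ‖v'‖ →
        |(‖v - z i‖ - ‖v‖) - (‖v' - z i‖ - ‖v'‖)| ≤ 6 * δ * ρ i := by
  obtain ⟨τ, hτ⟩ := exists_threshold_code ρ (fun i => (norm_nonneg _).trans (hz i)) hδ T
  obtain ⟨G, hG⟩ := exists_direction_code z hδ hn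
  refine ⟨fun v => (τ ‖v‖, G v), fun v v' h i h4 h4' => ?_⟩
  simp only [Prod.mk.injEq] at h
  obtain ⟨h1, h2⟩ := h
  have hdir := hG v v' h2 i
  have hzi := hz i
  have hz0 := norm_nonneg (z i)
  set r := ‖v‖ with hr
  set r' := ‖v'‖ with hr'
  have hrpos : 0 < r := by linarith
  have hrpos' : 0 < r' := by linarith
  set u := r⁻¹ • v with hu
  set u' := r'⁻¹ • v' with hu'
  have hvu : v = r • u := (norm_smul_inv_smul v).symm
  have hvu' : v' = r' • u' := (norm_smul_inv_smul v').symm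
  have hun : ‖u‖ = 1 := by
    rw [hu, norm_smul, norm_inv, Real.norm_of_nonneg hrpos.le]; exact inv_mul_cancel₀ hrpos.ne'
  have hun' : ‖u'‖ = 1 := by
    rw [hu', norm_smul, norm_inv, Real.norm_of_nonneg hrpos'.le]; exact inv_mul_cancel₀ hrpos'.ne'
  have hδz : 2 * δ * ‖z i‖ ≤ 2 * δ * ρ i := by gcongr
  have hsq : ∀ (t : ℝ) (w : E), ‖w‖ = 1 → ‖t • w - z i‖ ^ 2 = t ^ 2 - 2 * t * inner ℝ (z i) w + ‖z i‖ ^ 2 := by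
    intro t w hw
    rw [norm_sub_sq_real, norm_smul, hw, mul_one, Real.norm_eq_abs, sq_abs, real_inner_smul_left,
      real_inner_comm]
    ring
  -- Below saturation the radii agree up to δ * ρ i, and the change of direction remains to be
  -- bounded. Above it both vectors are so long that ‖t • w - z i‖ - t equals -⟨z i, w⟩ up to 2 * δ
  -- * ρ i, and the direction code gives this inner product.
  rcases hτ r r' hrpos.le hrpos'.le h1 i with hd | ⟨hb, hb'⟩
  · have t1 : |‖r • u - z i‖ - ‖r' • u - z i‖| ≤ δ * ρ i := by
      refine (abs_norm_sub_norm_le _ _).trans ?_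
      rw [sub_sub_sub_cancel_right, ← sub_smul, norm_smul, hun, mul_one]
      exact hd
    have t2 : |‖r' • u - z i‖ - ‖r' • u' - z i‖| ≤ 3 * δ * ρ i := by
      set a := ‖r' • u - z i‖ with ha
      set b := ‖r' • u' - z i‖ with hb
      have hab : a ^ 2 - b ^ 2 = -2 * r' * inner ℝ (z i) (u - u') := by
        rw [ha, hb, hsq _ _ hun, hsq _ _ hun', inner_sub_right]; ring
      have la : 3 / 4 * r' ≤ a := by
        have := norm_sub_norm_le (r' • u) (z i)
        rw [norm_smul, hun, mul_one, Real.norm_of_nonneg hrpos'.le] at this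
        linarith
      have lb : 3 / 4 * r' ≤ b := by
        have := norm_sub_norm_le (r' • u') (z i)
        rw [norm_smul, hun', mul_one, Real.norm_of_nonneg hrpos'.le] at this
        linarith
      have e : |a - b| * (a + b) = 2 * r' * |inner ℝ (z i) (u - u')| := by
        have hp : 0 ≤ a + b := by linarith
        rw [abs_mul_of_nonneg_right hp,
          show (a - b) * (a + b) = a ^ 2 - b ^ 2 by ring, hab, abs_mul, abs_mul, abs_neg, abs_two,
          abs_of_pos hrpos']
      have h5 : |a - b| * (3 / 2 * r') ≤ 2 * r' * (2 * δ * ρ i) := by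
        calc |a - b| * (3 / 2 * r') ≤ |a - b| * (a + b) := by gcongr; linarith
          _ = 2 * r' * |inner ℝ (z i) (u - u')| := e
          _ ≤ _ := by gcongr; linarith
      have h6 : r' * |a - b| ≤ r' * (8 / 3 * (δ * ρ i)) := by linarith
      have h7 := le_of_mul_le_mul_left h6 hrpos'
      have : 0 ≤ δ * ρ i := mul_nonneg hδ.le (by linarith)
      linarith
    rw [hvu, hvu']
    have a1 := abs_le.mp t1
    have a2 := abs_le.mp t2
    have a3 := abs_le.mp hd
    rw [abs_le]
    constructor <;> linarith [a1.1, a1.2, a2.1, a2.2, a3.1, a3.2]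
  · have main : ∀ (t : ℝ) (w : E), ‖w‖ = 1 → 0 < t → T * (δ * ρ i) ≤ t →
        |‖t • w - z i‖ - t + inner ℝ (z i) w| ≤ 2 * δ * ρ i := by
      intro t w hw ht hTt
      set c := inner ℝ (z i) w with hc
      have hcz : |c| ≤ ‖z i‖ := by
        have := abs_real_inner_le_norm (z i) w
        rwa [hw, mul_one] at this
      set a := ‖t • w - z i‖ with ha
      have ha0 : 0 ≤ a := norm_nonneg _
      have hat : |a - t| ≤ ‖z i‖ := by
        have h := abs_norm_sub_norm_le (t • w - z i) (t • w)
        rw [sub_sub_cancel_left, norm_neg, norm_smul t w, hw, mul_one,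
          Real.norm_of_nonneg ht.le] at h
        exact h
      have e : (a - t + c) * (a + t) = ‖z i‖ ^ 2 + c * (a - t) := by
        have := hsq t w hw
        rw [← ha, ← hc] at this
        linear_combination this
      have h5 : |a - t + c| * (a + t) ≤ 2 * ‖z i‖ ^ 2 := by
        have hp : 0 ≤ a + t := by linarith
        rw [abs_mul_of_nonneg_right hp, e]
        refine (abs_add_le _ _).trans ?_
        rw [abs_mul, abs_of_nonneg (sq_nonneg ‖z i‖)]
        have := mul_le_mul hcz hat (abs_nonneg _) hz0
        nlinarith
      have h6 : |a - t + c| * t ≤ 2 * ‖z i‖ ^ 2 := by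
        have := mul_nonneg (abs_nonneg (a - t + c)) ha0
        linarith
      have h7 : ‖z i‖ ^ 2 ≤ δ * ρ i * t := by
        have hρ0 : 0 ≤ ρ i := by linarith
        calc ‖z i‖ ^ 2 ≤ ρ i ^ 2 := by gcongr
          _ = 1 * ρ i ^ 2 := by ring
          _ ≤ T * δ ^ 2 * ρ i ^ 2 := by gcongr
          _ = δ * ρ i * (T * (δ * ρ i)) := by ring
          _ ≤ δ * ρ i * t := by gcongr
      have h8 : t * |a - t + c| ≤ t * (2 * δ * ρ i) := by linarith
      exact le_of_mul_le_mul_left h8 ht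
    have m1 := abs_le.mp (main r u hun hrpos hb)
    have m2 := abs_le.mp (main r' u' hun' hrpos' hb')
    rw [inner_sub_right] at hdir
    have m3 := abs_le.mp hdir
    rw [← hvu] at m1
    rw [← hvu'] at m2
    rw [abs_le]
    constructor <;> linarith [m1.1, m1.2, m2.1, m2.2, m3.1, m3.2]

end Codes

/-! ### Codes of tuples of centers that determine all relative costs. -/

section Nets

variable {d k m : ℕ}

/-- The relative cost of `q` for a point `a` of reference. -/
noncomputable def relCost (a q : Pt d) (S : Fin k → Pt d) : ℝ := ptCost q S - ptCost a S

theorem abs_relCost_le [NeZero k] (a q : Pt d) (S : Fin k → Pt d) :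
    |relCost a q S| ≤ dist q a := by
  have h1 := ptCost_le_add q a S
  have h2 := ptCost_le_add a q S
  rw [dist_comm] at h2
  unfold relCost
  rw [abs_le]
  constructor <;> linarith

theorem exists_subset_range [NeZero k] {x : ℕ} (X : Finset (Fin k)) (hX : X.card ≤ x) :
    ∃ e : Fin x → Fin k, ∀ j ∈ X, ∃ t, e t = j := by
  refine ⟨fun t => if h : (t : ℕ) < X.card then X.equivFin.symm ⟨t, h⟩ else 0, fun j hj => ?_⟩
  have hlt := (X.equivFin ⟨j, hj⟩).isLt
  exact ⟨⟨X.equivFin ⟨j, hj⟩, hlt.trans_le hX⟩, by simp⟩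

theorem ptCost_le_of_close [NeZero k] {q : Pt d} {r η : ℝ} {S S' : Fin k → Pt d}
    (h : ∀ s, dist q (S s) ≤ r → |dist q (S s) - dist q (S' s)| ≤ η) (hq : ptCost q S ≤ r) :
    ptCost q S' ≤ ptCost q S + η := by
  obtain ⟨s, hs⟩ := exists_ptCost_eq q S
  rw [hs] at hq ⊢
  have := (abs_le.mp (h s hq)).1
  linarith [ptCost_le q S' s]

theorem ptCost_close [NeZero k] {q : Pt d} {r η : ℝ} {S S' : Fin k → Pt d}
    (h : ∀ s, dist q (S s) ≤ r → |dist q (S s) - dist q (S' s)| ≤ η)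
    (h' : ∀ s, dist q (S' s) ≤ r → |dist q (S' s) - dist q (S s)| ≤ η)
    (hq : ptCost q S ≤ r) (hr : ptCost q S + η ≤ r) : |ptCost q S - ptCost q S'| ≤ η := by
  have h1 := ptCost_le_of_close h hq
  have h2 := ptCost_le_of_close h' (h1.trans hr)
  rw [abs_le]
  constructor <;> linarith

/-- The center serving q is at distance at most ptCost a S + 2ρ from a, hence it is a near center of
a; if there is only one, it also serves a. -/
theorem ptCost_eq_of_card_nearCenters [NeZero k] {q a : Pt d} {ρ : ℝ} {S : Fin k → Pt d}
    (hq : dist q a ≤ ρ) (hfar : 4 * ρ < ptCost a S) (hcard : (nearCenters S a).card < 2) {s : Fin k}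
    (hs : ptCost a S = dist a (S s)) : ptCost q S = dist q (S s) := by
  obtain ⟨s', hs'⟩ := exists_ptCost_eq q S
  have h0 : 0 ≤ dist q a := dist_nonneg
  have h1 := dist_triangle a q (S s')
  have h2 := ptCost_le_add q a S
  rw [dist_comm a q, ← hs'] at h1
  have m1 : s ∈ nearCenters S a := by
    simp only [nearCenters, Finset.mem_filter, Finset.mem_univ, true_and]
    linarith
  have m2 : s' ∈ nearCenters S a := by
    simp only [nearCenters, Finset.mem_filter, Finset.mem_univ, true_and]
    linarith
  have : s' = s := Finset.card_le_one.mp (by omega) s' m2 s m1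
  rw [hs', this]

/-- The relative cost is the minimum over s of a shift, dist q (S s) - dist a (S s), plus an excess,
dist a (S s) - ptCost a S. A minimizing s has excess at most 2ρ, so saturated excess codes are
harmless. -/
theorem relCost_le_of_code [NeZero k] {q a : Pt d} {ρ δ T : ℝ} {S S' : Fin k → Pt d}
    (hρ : 0 < ρ) (hq : dist q a ≤ ρ) (hT : 33 ≤ T * δ)
    (hg : ∀ s, |(dist q (S s) - dist a (S s)) - (dist q (S' s) - dist a (S' s))| ≤ 6 * δ * ρ)
    (hD : ∀ s, |(dist a (S s) - ptCost a S) - (dist a (S' s) - ptCost a S')| ≤ δ * ρ ∨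
      T * (δ * ρ) ≤ dist a (S s) - ptCost a S) :
    relCost a q S' ≤ relCost a q S + 7 * δ * ρ := by
  obtain ⟨s, hs⟩ := exists_ptCost_eq q S
  have h1 := dist_triangle a q (S s)
  have h2 := ptCost_le_add q a S
  rw [dist_comm a q, ← hs] at h1
  rcases hD s with h | h
  · have h3 := abs_le.mp h
    have h4 := abs_le.mp (hg s)
    have h5 := ptCost_le q S' s
    unfold relCost
    rw [hs] at *
    linarith [h3.1, h4.1]
  · have : 33 * ρ ≤ T * δ * ρ := mul_le_mul_of_nonneg_right hT hρ.le
    linarith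

/-- Codes of `k`-tuples of centers. -/
abbrev Code (m k n T x : ℕ) : Type :=
  (Fin k → (Bool × Fin m) × Fin (m * T + 1) × (Fin n → Option (Bool × (Bool × Fin m)))) ×
  (Fin k → Fin k × (Fin (m * T + 1) × (Fin n → Option (Bool × Fin m)))) ×
  (Fin x → Fin k) ×
  (Fin x → Fin k → (Fin (m * T + 1) × (Fin n → Option (Bool × Fin m))) × Fin (m * T + 1))

set_option synthInstance.maxHeartbeats 400000 in
set_option synthInstance.maxSize 1024 in
theorem card_code_le {m k n T x B : ℕ} (hm : 4 * m + 1 ≤ B) (hT : m * T + 1 ≤ B) (hk : k ≤ B) :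
    Nat.card (Code m k n T x) ≤ B ^ ((n + 2) * (k * (2 + x)) + x) := by
  rw [Nat.card_eq_fintype_card]
  simp only [Code, Fintype.card_prod, Fintype.card_fun, Fintype.card_fin, Fintype.card_option,
    Fintype.card_bool]
  calc _ ≤ (B * (B * B ^ n)) ^ k * ((B * (B * B ^ n)) ^ k * (B ^ x * ((B * B ^ n * B) ^ k) ^ x)) := by
        gcongr <;> omega
    _ = _ := by
        simp only [← pow_succ, ← pow_succ', ← pow_mul, ← pow_add]
        congr 1
        ring

/-- The components of the code serve three cases. If one of the tuples is within 4 * ρ i of the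
reference point, the distance codes for the terminals q i and A (c i) give both costs, with error 2
* 135. If both are farther and c i is in the stored list, shift and excess are known for all k
centers. If c i is not in the list, the cluster is unambiguous for both tuples, and the shift of the
center nearest to A (c i) is enough. -/
theorem exists_center_code [NeZero k] (hm : 0 < m) (q : Fin m → Pt d) (A : Fin k → Pt d)
    (c : Fin m → Fin k) (ρ : Fin m → ℝ) (hρ : ∀ i, dist (q i) (A (c i)) ≤ ρ i) {δ : ℝ} (hδ : 0 < δ)
    (hδ8 : δ ≤ 1 / 8) {n : ℕ} (hn : 1 ≤ n * δ ^ 2) {T : ℕ} (hT : 33 ≤ T * δ ^ 2) (x : ℕ) :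
    ∃ κ : (Fin k → Pt d) → Code m k n T x, ∀ S S', (ambiguous A S).card ≤ x →
      (ambiguous A S').card ≤ x → κ S = κ S' →
      ∀ i, |relCost (A (c i)) (q i) S - relCost (A (c i)) (q i) S'| ≤ 270 * δ * ρ i := by
  have : Nonempty (Fin m) := ⟨⟨0, hm⟩⟩
  have hρ0 : ∀ i, 0 ≤ ρ i := fun i => dist_nonneg.trans (hρ i)
  have hT1 : 33 ≤ (T : ℝ) * δ := by
    have : (0 : ℝ) ≤ T := Nat.cast_nonneg _
    have h : (T : ℝ) * δ ^ 2 ≤ T * δ := by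
      apply mul_le_mul_of_nonneg_left _ this
      nlinarith
    linarith
  obtain ⟨α, hα⟩ := exists_distance_code
    (fun z : Bool × Fin m => if z.1 then q z.2 else A (c z.2)) ρ hρ0 hδ (by linarith) hn hT1
  obtain ⟨φ, hφ⟩ := exists_shift_code (fun i => q i - A (c i)) ρ
    (fun i => by rw [← dist_eq_norm]; exact hρ i) hδ hn (by linarith)
  obtain ⟨τ, hτ⟩ := exists_threshold_code ρ hρ0 hδ T
  have hnear : ∀ S : Fin k → Pt d, ∃ f : Fin k → Fin k, ∀ j, ptCost (A j) S = dist (A j) (S (f j)) :=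
    fun S => ⟨fun j => (exists_ptCost_eq (A j) S).choose, fun j => (exists_ptCost_eq (A j) S).choose_spec⟩
  choose f hf using hnear
  have hlist : ∀ S : Fin k → Pt d, ∃ e : Fin x → Fin k, (ambiguous A S).card ≤ x →
      ∀ j ∈ ambiguous A S, ∃ t, e t = j := by
    intro S
    by_cases h : (ambiguous A S).card ≤ x
    · obtain ⟨e, he⟩ := exists_subset_range _ h
      exact ⟨e, fun _ => he⟩
    · exact ⟨fun _ => 0, fun h' => absurd h' h⟩
  choose e he using hlist
  refine ⟨fun S => (fun s => α (S s), fun j => (f S j, φ (S (f S j) - A j)), e S,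
    fun t s => (φ (S s - A (e S t)), τ (dist (A (e S t)) (S s) - ptCost (A (e S t)) S))),
    fun S S' hS hS' h i => ?_⟩
  simp only [Prod.mk.injEq] at h
  obtain ⟨h1, h2, h3, h4⟩ := h
  rw [← h3] at h4
  set a := A (c i) with ha
  have hqi := hρ i
  rw [← ha] at hqi
  rcases (hρ0 i).eq_or_lt with h0 | hpos
  · have b1 := abs_relCost_le a (q i) S
    have b2 := abs_relCost_le a (q i) S'
    rw [← h0] at hqi ⊢
    have c1 := abs_le.mp b1
    have c2 := abs_le.mp b2
    rw [abs_le]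
    constructor <;> linarith [c1.1, c1.2, c2.1, c2.2]
  have hδρ : 0 ≤ δ * ρ i := by positivity
  have hδρ8 : δ * ρ i ≤ 1 / 8 * ρ i := mul_le_mul_of_nonneg_right hδ8 hpos.le
  -- The costs of q i and a are at most 5 * ρ i, and 5 + 135/8 < 32, so the distance code remains in
  -- range for both tuples.
  have near : ∀ U U' : Fin k → Pt d, (∀ s, α (U s) = α (U' s)) → ptCost a U ≤ 4 * ρ i →
      |relCost a (q i) U - relCost a (q i) U'| ≤ 270 * δ * ρ i := by
    intro U U' hU hR
    have hq4 := ptCost_le_add (q i) a U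
    have e1 := ptCost_close (q := q i) (r := 32 * ρ i) (η := 135 * δ * ρ i)
      (fun s hs => by simpa using hα _ _ (hU s) (true, i) i hpos (by simpa using hs))
      (fun s hs => by simpa using hα _ _ (hU s).symm (true, i) i hpos (by simpa using hs))
      (by linarith) (by linarith)
    have e2 := ptCost_close (q := a) (r := 32 * ρ i) (η := 135 * δ * ρ i)
      (fun s hs => by simpa using hα _ _ (hU s) (false, i) i hpos (by simpa using hs))
      (fun s hs => by simpa using hα _ _ (hU s).symm (false, i) i hpos (by simpa using hs))
      (by linarith) (by linarith)
    unfold relCost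
    have c1 := abs_le.mp e1
    have c2 := abs_le.mp e2
    rw [abs_le]
    constructor <;> linarith [c1.1, c1.2, c2.1, c2.2]
  by_cases hR : ptCost a S ≤ 4 * ρ i
  · exact near S S' (fun s => congrFun h1 s) hR
  by_cases hR' : ptCost a S' ≤ 4 * ρ i
  · rw [abs_sub_comm]
    exact near S' S (fun s => (congrFun h1 s).symm) hR'
  push Not at hR hR'
  have shift : ∀ s s', φ (S s - a) = φ (S' s' - a) →
      |(dist (q i) (S s) - dist a (S s)) - (dist (q i) (S' s') - dist a (S' s'))| ≤ 6 * δ * ρ i := by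
    intro s s' hss
    have l1 := ptCost_le a S s
    have l2 := ptCost_le a S' s'
    have hd : ∀ y b : Pt d, dist b y = ‖y - b‖ := fun y b => by rw [dist_comm, dist_eq_norm]
    rw [hd] at l1 l2
    have := hφ _ _ hss i (by linarith) (by linarith)
    rw [← ha, sub_sub_sub_cancel_right, sub_sub_sub_cancel_right] at this
    simpa only [hd] using this
  by_cases hmem : ∃ t, e S t = c i
  · obtain ⟨t, ht⟩ := hmem
    have h5 := fun s => congrFun (congrFun h4 t) s
    simp only [ht, Prod.mk.injEq, ← ha] at h5
    have hD : ∀ s, |(dist a (S s) - ptCost a S) - (dist a (S' s) - ptCost a S')| ≤ δ * ρ i ∨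
        (T * (δ * ρ i) ≤ dist a (S s) - ptCost a S ∧ T * (δ * ρ i) ≤ dist a (S' s) - ptCost a S') :=
      fun s => hτ _ _ (sub_nonneg.mpr (ptCost_le _ _ _)) (sub_nonneg.mpr (ptCost_le _ _ _)) (h5 s).2 i
    have r1 := relCost_le_of_code hpos hqi hT1 (fun s => shift s s (h5 s).1)
      (fun s => (hD s).imp id And.left)
    have r2 := relCost_le_of_code (S := S') (S' := S) hpos hqi hT1
      (fun s => by rw [abs_sub_comm]; exact shift s s (h5 s).1)
      (fun s => (hD s).imp (fun h => by rwa [abs_sub_comm]) And.right)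
    rw [abs_le]
    constructor <;> linarith
  · have hc : ∀ U : Fin k → Pt d, (ambiguous A U).card ≤ x → e U = e S →
        (nearCenters U (A (c i))).card < 2 := by
      intro U hU heU
      by_contra hcon
      have : c i ∈ ambiguous A U := by
        simp only [ambiguous, Finset.mem_filter, Finset.mem_univ, true_and]
        omega
      obtain ⟨t, ht⟩ := he U hU _ this
      exact hmem ⟨t, by rw [← heU, ht]⟩
    have h5 := congrFun h2 (c i)
    simp only [Prod.mk.injEq, ← ha] at h5
    have k1 := ptCost_eq_of_card_nearCenters hqi hR (hc S hS rfl) (hf S (c i))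
    have k2 := ptCost_eq_of_card_nearCenters hqi hR' (hc S' hS' h3.symm) (hf S' (c i))
    have k3 := shift _ _ h5.2
    have k4 := hf S (c i)
    have k5 := hf S' (c i)
    rw [← ha] at k4 k5
    unfold relCost
    rw [k1, k2, k4, k5]
    linarith

end Nets

/-! ### Chaining for the relative costs of a fixed sample. -/

section Sample

variable {d k m : ℕ}

set_option synthInstance.maxHeartbeats 400000 in
set_option synthInstance.maxSize 1024 in
instance finite_code {m k n T x : ℕ} : Finite (Code m k n T x) := inferInstance

theorem one_le_log_natCast (n : ℕ) (hn : 3 ≤ n) : 1 ≤ Real.log n := by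
  rw [Real.le_log_iff_exp_le (by exact_mod_cast (by omega : 0 < n))]
  have h : (3 : ℝ) ≤ n := by exact_mod_cast hn
  linarith [Real.exp_one_lt_d9]

/-- For δ = 1/(8 * 2^h), these values of n and T are those with n δ² = 1 and T δ² = 33. Every
alphabet of the code has at most 3000 * 4^h * m letters. -/
theorem log_card_code_le (hk : 1 ≤ k) (hkm : k ≤ m) (x : ℕ) {h H : ℕ} (hh : h ≤ H) :
    Real.log (Nat.card (Code m k (64 * 4 ^ h) (2112 * 4 ^ h) x) : ℝ) ≤
      4 ^ h * (132 * k * (1 + x) * (Real.log (3000 * m) + 2 * H)) := by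
  rcases Nat.eq_zero_or_pos (Nat.card (Code m k (64 * 4 ^ h) (2112 * 4 ^ h) x)) with h0 | hpos
  · rw [h0]
    simp only [Nat.cast_zero, Real.log_zero]
    have : 0 ≤ Real.log (3000 * m) := Real.log_nonneg (by
      have : (1 : ℝ) ≤ m := by exact_mod_cast hk.trans hkm
      linarith)
    positivity
  have hm : 1 ≤ m := hk.trans hkm
  have h4 : 1 ≤ 4 ^ h := Nat.one_le_pow _ _ (by norm_num)
  have hm4 : m ≤ 4 ^ h * m := Nat.le_mul_of_pos_left _ h4
  have hB := card_code_le (m := m) (k := k) (n := 64 * 4 ^ h) (T := 2112 * 4 ^ h) (x := x)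
    (B := 3000 * (4 ^ h * m)) (by omega) (by
      have : m * (2112 * 4 ^ h) = 2112 * (4 ^ h * m) := by ring
      omega) (by omega)
  have hexp : (64 * 4 ^ h + 2) * (k * (2 + x)) + x ≤ 4 ^ h * (132 * k * (1 + x)) := by
    have e1 : (64 * 4 ^ h + 2) * (k * (2 + x)) ≤ (66 * 4 ^ h) * (k * (2 + x)) :=
      Nat.mul_le_mul_right _ (by omega)
    have e2 : x ≤ 4 ^ h * (k * x) := by
      calc x = 1 * (1 * x) := by ring
        _ ≤ 4 ^ h * (k * x) := by gcongr
    nlinarith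
  have h1 : Real.log (Nat.card (Code m k (64 * 4 ^ h) (2112 * 4 ^ h) x) : ℝ) ≤
      Real.log ((3000 * (4 ^ h * m) : ℝ) ^ (4 ^ h * (132 * k * (1 + x)))) := by
    refine Real.log_le_log (by exact_mod_cast hpos) ?_
    exact_mod_cast hB.trans (Nat.pow_le_pow_right (by omega) hexp)
  refine h1.trans ?_
  have hmR : (0 : ℝ) < m := by exact_mod_cast hm
  rw [Real.log_pow, show (3000 * (4 ^ h * m) : ℝ) = 4 ^ h * (3000 * m) by ring,
    Real.log_mul (by positivity) (by positivity), Real.log_pow]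
  push_cast
  have hl4 : Real.log 4 ≤ 2 := by
    rw [show (4 : ℝ) = 2 ^ 2 by norm_num, Real.log_pow]
    have := Real.log_two_lt_d9
    push_cast; linarith
  have hl0 : 0 ≤ Real.log 4 := Real.log_nonneg (by norm_num)
  have hhH : (h : ℝ) ≤ H := by exact_mod_cast hh
  have : (h : ℝ) * Real.log 4 + Real.log (3000 * m) ≤ Real.log (3000 * m) + 2 * H := by nlinarith
  calc _ ≤ (4 : ℝ) ^ h * (132 * k * (1 + x)) * (Real.log (3000 * m) + 2 * H) := by gcongr
    _ = _ := by ring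

theorem signExpect_relCost_le (hk : 1 ≤ k) (hkm : k ≤ m) (q : Fin m → Pt d) (A : Fin k → Pt d)
    (c : Fin m → Fin k) (ρ w : Fin m → ℝ) (hρ : ∀ i, dist (q i) (A (c i)) ≤ ρ i) {b : ℝ} (hb : 0 < b)
    (hw : ∀ i, 0 ≤ w i) (hwρ : ∀ i, w i * ρ i ≤ b) (x : ℕ) {ι : Type*} [Fintype ι] [Nonempty ι]
    (S : ι → Fin k → Pt d) (hS : ∀ t, (ambiguous A (S t)).card ≤ x) (H : ℕ) :
    signExpect (fun e : Fin m → Bool =>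
        ⨆ t, |∑ i, sgn (e i) * (w i * relCost (A (c i)) (q i) (S t))|) ≤
      8 * H * (34 * b) * √(m * (132 * k * (1 + x) * (Real.log (3000 * m) + 2 * H))) +
        34 * b * m / 2 ^ H := by
  have : NeZero k := ⟨by omega⟩
  have hm : 0 < m := by omega
  have hk1 : (1 : ℝ) ≤ k := by exact_mod_cast hk
  have hm1 : (1 : ℝ) ≤ m := by exact_mod_cast hm
  have hlog : 1 ≤ Real.log (3000 * m) := by
    have := one_le_log_natCast (3000 * m) (by omega)
    exact_mod_cast this
  refine chaining (fun t i => w i * relCost (A (c i)) (q i) (S t)) (34 * b) _ (by positivity) hm ?_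
    ?_ H ?_
  · have h1 : (1 : ℝ) ≤ 132 * k * (1 + x) := by
      have : (0 : ℝ) ≤ x := Nat.cast_nonneg x
      nlinarith
    have h2 : 1 ≤ Real.log (3000 * m) + 2 * H := by
      have : (0 : ℝ) ≤ H := Nat.cast_nonneg H
      linarith
    exact one_le_mul_of_one_le_of_one_le h1 h2
  · intro t i
    rw [abs_mul, abs_of_nonneg (hw i)]
    have := mul_le_mul_of_nonneg_left ((abs_relCost_le (A (c i)) (q i) (S t)).trans (hρ i)) (hw i)
    linarith [hwρ i]
  · intro h hh
    have h2 : (0 : ℝ) < 2 ^ h := by positivity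
    have e4 : (4 : ℝ) ^ h = (2 ^ h) ^ 2 := by rw [← pow_mul, mul_comm, pow_mul]; norm_num
    obtain ⟨κ, hκ⟩ := exists_center_code hm q A c ρ hρ (δ := 1 / (8 * 2 ^ h)) (by positivity)
      (by
        rw [div_le_div_iff₀ (by positivity) (by norm_num)]
        have : (1 : ℝ) ≤ 2 ^ h := one_le_pow₀ (by norm_num)
        linarith)
      (n := 64 * 4 ^ h) (by push_cast; rw [e4]; apply le_of_eq; field_simp; norm_num)
      (T := 2112 * 4 ^ h) (by push_cast; rw [e4]; apply le_of_eq; field_simp; norm_num) x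
    let g : ι → Code m k (64 * 4 ^ h) (2112 * 4 ^ h) x := fun t => κ (S t)
    -- Each index is replaced by a representative with the same code. The representative lies in the
    -- family, so its ambiguity is bounded by x too. The accuracy 270/8 ≤ 34 explains the factor 34.
    refine ⟨fun t => Function.invFun g (g t), ?_, fun t i => ?_⟩
    · refine le_trans ?_ (log_card_code_le hk hkm x hh)
      refine Real.log_le_log ?_ ?_
      · exact_mod_cast (Set.ncard_pos (Set.toFinite _)).mpr (Set.range_nonempty _)
      · have h1 : (Set.range fun t => Function.invFun g (g t)) ⊆ Set.range (Function.invFun g) := by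
          rintro _ ⟨t, rfl⟩; exact ⟨_, rfl⟩
        have h2 : (Set.range (Function.invFun g)).ncard ≤
            Nat.card (Code m k (64 * 4 ^ h) (2112 * 4 ^ h) x) := by
          rw [← Set.image_univ, ← Set.ncard_univ]
          exact Set.ncard_image_le (Set.toFinite _)
        exact_mod_cast (Set.ncard_le_ncard h1 (Set.toFinite _)).trans h2
    · have hg : g (Function.invFun g (g t)) = g t := Function.apply_invFun_apply
      have h1 := hκ _ _ (hS t) (hS (Function.invFun g (g t))) hg.symm i
      rw [← mul_sub, abs_mul, abs_of_nonneg (hw i)]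
      calc w i * _ ≤ w i * (270 * (1 / (8 * 2 ^ h)) * ρ i) := mul_le_mul_of_nonneg_left h1 (hw i)
        _ = 270 / 8 / 2 ^ h * (w i * ρ i) := by field_simp
        _ ≤ 270 / 8 / 2 ^ h * b := mul_le_mul_of_nonneg_left (hwρ i) (by positivity)
        _ ≤ 34 * b / 2 ^ h := by
          rw [div_mul_eq_mul_div]
          gcongr
          norm_num

end Sample

/-! ### Bounds on the sampling probabilities and expected deviations. -/

section Scores

variable {d k m : ℕ} {P : Finset (Pt d)} {A : Fin k → Pt d} {σ : Pt d → Fin k}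

theorem sum_cluster (P : Finset (Pt d)) (σ : Pt d → Fin k) (g : Pt d → ℝ) :
    ∑ j, ∑ p ∈ cluster P σ j, g p = ∑ p ∈ P, g p :=
  Finset.sum_fiberwise _ _ _

theorem sum_cost_cluster (P : Finset (Pt d)) (σ : Pt d → Fin k) (A : Fin k → Pt d) :
    ∑ j, cost (cluster P σ j) A = cost P A :=
  sum_cluster P σ fun p => ptCost p A

theorem sum_le_of_cluster {g : Pt d → ℝ} {b : Fin k → ℝ}
    (h : ∀ j, ∑ p ∈ cluster P σ j, g p ≤ b j) : ∑ p ∈ P, g p ≤ ∑ j, b j := by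
  rw [← sum_cluster P σ g]
  exact Finset.sum_le_sum fun j _ => h j

theorem eq_of_mem_cluster {p : Pt d} {j : Fin k} (h : p ∈ cluster P σ j) : σ p = j := by
  simpa [cluster] using (Finset.mem_filter.mp h).2

theorem mul_div_le_left {a b : ℝ} (ha : 0 ≤ a) : b * (a / b) ≤ a := by
  rw [mul_div_left_comm]
  exact mul_le_of_le_one_right ha (div_self_le_one b)

theorem sum_avgCost_le : ∑ p ∈ P, avgCost P A σ p ≤ cost P A := by
  rw [← sum_cost_cluster P σ A]
  refine sum_le_of_cluster (σ := σ) fun j => ?_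
  have : ∀ p ∈ cluster P σ j, avgCost P A σ p = cost (cluster P σ j) A / (cluster P σ j).card := by
    intro p hp
    rw [avgCost, eq_of_mem_cluster hp]
  rw [Finset.sum_congr rfl this, Finset.sum_const, nsmul_eq_mul]
  exact mul_div_le_left (cost_nonneg _ _)

theorem avgCost_nonneg (p : Pt d) : 0 ≤ avgCost P A σ p :=
  div_nonneg (cost_nonneg _ _) (Nat.cast_nonneg _)

/-- Each of the four terms sums to at most 1, since the convention 0/0 = 0 can only lose mass.
Normalizing therefore only raises the probabilities. -/
theorem sum_score_le_one : ∑ p ∈ P, score P A σ p ≤ 1 := by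
  have hk : ∑ _j : Fin k, (1 / k : ℝ) ≤ 1 := by
    rw [Finset.sum_const, Finset.card_univ, Fintype.card_fin, nsmul_eq_mul]
    exact mul_div_le_left zero_le_one
  have t1 : ∑ p ∈ P, 1 / ((k : ℝ) * ((cluster P σ (σ p)).card : ℝ)) ≤ 1 := by
    refine (sum_le_of_cluster (σ := σ) fun j => ?_).trans hk
    have : ∀ p ∈ cluster P σ j, 1 / ((k : ℝ) * ((cluster P σ (σ p)).card : ℝ)) =
        1 / k / (cluster P σ j).card := by
      intro p hp
      rw [eq_of_mem_cluster hp, div_div]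
    rw [Finset.sum_congr rfl this, Finset.sum_const, nsmul_eq_mul]
    exact mul_div_le_left (by positivity)
  have t2 : ∑ p ∈ P, ptCost p A / ((k : ℝ) * cost (cluster P σ (σ p)) A) ≤ 1 := by
    refine (sum_le_of_cluster (σ := σ) fun j => ?_).trans hk
    have : ∀ p ∈ cluster P σ j, ptCost p A / ((k : ℝ) * cost (cluster P σ (σ p)) A) =
        ptCost p A * (1 / k / cost (cluster P σ j) A) := by
      intro p hp
      rw [eq_of_mem_cluster hp, div_div, mul_one_div]
    rw [Finset.sum_congr rfl this, ← Finset.sum_mul]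
    exact mul_div_le_left (by positivity)
  have t3 : ∑ p ∈ P, ptCost p A / cost P A ≤ 1 := by
    rw [← Finset.sum_div]
    exact div_self_le_one _
  have t4 : ∑ p ∈ P, avgCost P A σ p / cost P A ≤ 1 := by
    rw [← Finset.sum_div]
    exact (div_le_div_of_nonneg_right sum_avgCost_le (cost_nonneg _ _)).trans (div_self_le_one _)
  unfold score
  rw [← Finset.mul_sum, Finset.sum_add_distrib, Finset.sum_add_distrib, Finset.sum_add_distrib]
  linarith

theorem sum_score_pos (hP : P.Nonempty) : 0 < ∑ x ∈ P, score P A σ x :=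
  Finset.sum_pos (fun p hp => score_pos P A σ p hp) hP

theorem mu_pos {p : Pt d} (hp : p ∈ P) : 0 < mu P A σ p :=
  div_pos (score_pos P A σ p hp) (sum_score_pos ⟨p, hp⟩)

theorem sum_mu (hP : P.Nonempty) : ∑ p ∈ P, mu P A σ p = 1 := by
  unfold mu
  rw [← Finset.sum_div, div_self (sum_score_pos hP).ne']

theorem score_le_mu {p : Pt d} (hp : p ∈ P) : score P A σ p ≤ mu P A σ p := by
  rw [mu, le_div_iff₀ (sum_score_pos ⟨p, hp⟩)]
  exact mul_le_of_le_one_right (score_pos P A σ p hp).le sum_score_le_one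

theorem card_cluster_pos {p : Pt d} (hp : p ∈ P) : (0 : ℝ) < (cluster P σ (σ p)).card := by
  exact_mod_cast Finset.card_pos.mpr ⟨p, by simp [cluster, hp]⟩

/-- This comes from the first term of the score and keeps the cluster weights below 4k. -/
theorem one_le_card_mul_mu {p : Pt d} (hp : p ∈ P) :
    1 ≤ 4 * k * ((cluster P σ (σ p)).card * mu P A σ p) := by
  have hk : (0 : ℝ) < k := by exact_mod_cast (σ p).pos
  have hc := card_cluster_pos (σ := σ) hp
  have h1 := ptCost_nonneg p A
  have h2 := cost_nonneg P A
  have h3 := cost_nonneg (cluster P σ (σ p)) A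
  have h4 : 0 ≤ avgCost P A σ p := avgCost_nonneg p
  have h5 : 1 / 4 * (1 / ((k : ℝ) * (cluster P σ (σ p)).card)) ≤ mu P A σ p := by
    refine le_trans ?_ (score_le_mu hp)
    unfold score
    have b1 : 0 ≤ ptCost p A / ((k : ℝ) * cost (cluster P σ (σ p)) A) := by positivity
    have b2 : 0 ≤ ptCost p A / cost P A := by positivity
    have b3 : 0 ≤ avgCost P A σ p / cost P A := by positivity
    linarith
  rw [mul_one_div, div_le_iff₀ (by positivity)] at h5
  linarith

/-- This comes from the last two terms of the score and bounds the weighted relative costs by 4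
cost(P, A). If cost(P, A) = 0, both sides vanish. -/
theorem ptCost_add_avgCost_le {p : Pt d} (hp : p ∈ P) :
    ptCost p A + avgCost P A σ p ≤ 4 * cost P A * mu P A σ p := by
  have hk : (0 : ℝ) < k := by exact_mod_cast (σ p).pos
  have h1 := ptCost_nonneg p A
  have h4 : 0 ≤ avgCost P A σ p := avgCost_nonneg p
  have h3 := cost_nonneg (cluster P σ (σ p)) A
  rcases (cost_nonneg P A).eq_or_lt with h0 | hpos
  · have e1 : ptCost p A ≤ cost P A :=
      Finset.single_le_sum (f := fun p => ptCost p A) (fun x _ => ptCost_nonneg x A) hp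
    have e2 : avgCost P A σ p ≤ cost P A :=
      (Finset.single_le_sum (f := fun p => avgCost P A σ p) (fun x _ => avgCost_nonneg x) hp).trans
        sum_avgCost_le
    rw [← h0] at e1 e2 ⊢
    linarith
  · have h5 : 1 / 4 * ((ptCost p A + avgCost P A σ p) / cost P A) ≤ mu P A σ p := by
      refine le_trans ?_ (score_le_mu hp)
      unfold score
      have b1 : 0 ≤ ptCost p A / ((k : ℝ) * cost (cluster P σ (σ p)) A) := by positivity
      have b2 : 0 ≤ 1 / ((k : ℝ) * (cluster P σ (σ p)).card) := by positivity
      rw [add_div]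
      linarith
    rw [← mul_div_assoc, div_le_iff₀ hpos] at h5
    linarith

/-- The sampling distribution, as weights on the subtype of points of `P`. -/
noncomputable def nu (P : Finset (Pt d)) (A : Fin k → Pt d) (σ : Pt d → Fin k) (p : {x // x ∈ P}) :
    ℝ := mu P A σ p

theorem nu_pos (p : {x // x ∈ P}) : 0 < nu P A σ p := mu_pos p.2

theorem sum_nu (hP : P.Nonempty) : ∑ p, nu P A σ p = 1 := by
  rw [← sum_mu (A := A) (σ := σ) hP, ← Finset.sum_coe_sort P fun p => mu P A σ p]
  rfl

theorem sum_nu_mul_div (g : Pt d → ℝ) :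
    ∑ p : {x // x ∈ P}, nu P A σ p * (1 / nu P A σ p * g p) = ∑ p ∈ P, g p := by
  rw [← Finset.sum_coe_sort P g]
  refine Finset.sum_congr rfl fun p _ => ?_
  rw [← mul_assoc, mul_one_div_cancel (nu_pos p).ne', one_mul]

/-- The expected uniform deviation of the relative costs over a family of solutions with at most `x`
ambiguous clusters. -/
theorem expect_relCost_le (hP : P.Nonempty) (hσ : IsNearest P A σ) (hA : 0 < cost P A)
    (hk : 1 ≤ k) (hkm : k ≤ m) (x : ℕ) {ι : Type*} [Fintype ι] [Nonempty ι] (S : ι → Fin k → Pt d)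
    (hS : ∀ t, (ambiguous A (S t)).card ≤ x) (H : ℕ) :
    expect (nu P A σ) (fun q : Fin m → {x // x ∈ P} => ⨆ t,
      |∑ i, 1 / nu P A σ (q i) * relCost (A (σ (q i))) (q i) (S t) -
        m * ∑ p ∈ P, relCost (A (σ p)) p (S t)|) ≤
      2 * (8 * H * (34 * (4 * cost P A)) *
        √(m * (132 * k * (1 + x) * (Real.log (3000 * m) + 2 * H))) +
          34 * (4 * cost P A) * m / 2 ^ H) := by
  have h0 : ∀ p : {x // x ∈ P}, 0 ≤ nu P A σ p := fun p => (nu_pos p).le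
  have hsym := symmetrization (m := m) (μ := nu P A σ) h0 (sum_nu hP)
    (fun t p => 1 / nu P A σ p * relCost (A (σ p)) p (S t))
  have hmean := fun t => sum_nu_mul_div (P := P) (A := A) (σ := σ)
    fun p => relCost (A (σ p)) p (S t)
  simp only [hmean] at hsym
  refine hsym.trans (mul_le_mul_of_nonneg_left ?_ zero_le_two)
  have hb : ∀ q : Fin m → {x // x ∈ P}, signExpect (fun e : Fin m → Bool => ⨆ t,
      |∑ i, sgn (e i) * (1 / nu P A σ (q i) * relCost (A (σ (q i))) (q i) (S t))|) ≤
      8 * H * (34 * (4 * cost P A)) *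
        √(m * (132 * k * (1 + x) * (Real.log (3000 * m) + 2 * H))) +
          34 * (4 * cost P A) * m / 2 ^ H := by
    intro q
    refine signExpect_relCost_le hk hkm (fun i => (q i : Pt d)) A (fun i => σ (q i))
      (fun i => ptCost (q i : Pt d) A + avgCost P A σ (q i)) (fun i => 1 / nu P A σ (q i))
      (fun i => ?_) (by positivity) (fun i => ?_) (fun i => ?_) x S hS H
    · rw [← ptCost_eq_of_isNearest hσ (q i).2]
      exact le_add_of_nonneg_right (avgCost_nonneg _)
    · exact div_nonneg zero_le_one (h0 _)
    · rw [one_div_mul_eq_div, div_le_iff₀ (nu_pos _)]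
      exact ptCost_add_avgCost_le (q i).2
  have := expect_mono (m := m) h0 hb
  rwa [expect_const (sum_nu hP)] at this

/-- The importance weight of a point of the cluster `C_j`, relative to the size of `C_j`. -/
noncomputable def clusterWeight (P : Finset (Pt d)) (A : Fin k → Pt d) (σ : Pt d → Fin k) (j : Fin k)
    (p : {x // x ∈ P}) : ℝ :=
  1 / nu P A σ p * (if σ p = j then 1 / ((cluster P σ j).card : ℝ) else 0)

theorem clusterWeight_nonneg (j : Fin k) (p : {x // x ∈ P}) : 0 ≤ clusterWeight P A σ j p := by
  have := nu_pos (A := A) (σ := σ) p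
  unfold clusterWeight
  split_ifs <;> positivity

theorem clusterWeight_le (j : Fin k) (p : {x // x ∈ P}) : clusterWeight P A σ j p ≤ 4 * k := by
  have h := nu_pos (A := A) (σ := σ) p
  unfold clusterWeight
  split_ifs with hj
  · subst hj
    have hc := card_cluster_pos (σ := σ) p.2
    rw [one_div_mul_one_div, div_le_iff₀ (by positivity), mul_comm (nu P A σ p)]
    exact one_le_card_mul_mu p.2
  · rw [mul_zero]; positivity

theorem sum_ite_cluster (j : Fin k) (c : ℝ) :
    ∑ p ∈ P, (if σ p = j then c else 0) = (cluster P σ j).card * c := by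
  rw [← Finset.sum_filter, Finset.sum_const, nsmul_eq_mul]
  rfl

theorem sum_nu_mul_clusterWeight (j : Fin k) :
    ∑ p, nu P A σ p * clusterWeight P A σ j p =
      (cluster P σ j).card * (1 / ((cluster P σ j).card : ℝ)) := by
  rw [← sum_ite_cluster, ← sum_nu_mul_div (A := A) (σ := σ)]
  rfl

/-- A self-bounding argument: weights in [0, 4k] have square sum at most 4k(m + X), where X is the
deviation itself. With the fixed parameter θ/(8k), `massart` gives a bound linear in X, so the
expectation satisfies E X ≤ θm + (θ/2) E X, and the last term is absorbed. -/
theorem expect_clusterWeight_le (hP : P.Nonempty) (hk : 1 ≤ k) {θ : ℝ} (hθ : 0 < θ)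
    (hθ1 : θ ≤ 1) (hθm : 32 * k * Real.log (2 * k) ≤ θ ^ 2 * m) :
    expect (nu P A σ) (fun q : Fin m → {x // x ∈ P} => ⨆ j,
      |∑ i, clusterWeight P A σ j (q i) -
        m * ∑ p, nu P A σ p * clusterWeight P A σ j p|) ≤ 2 * θ * m := by
  have : NeZero k := ⟨by omega⟩
  have h0 : ∀ p : {x // x ∈ P}, 0 ≤ nu P A σ p := fun p => (nu_pos p).le
  have hkR : (0 : ℝ) < k := by exact_mod_cast hk
  set X : (Fin m → {x // x ∈ P}) → ℝ := fun q => ⨆ j, |∑ i, clusterWeight P A σ j (q i) -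
        m * ∑ p, nu P A σ p * clusterWeight P A σ j p| with hX
  have hsym : expect (nu P A σ) X ≤ _ :=
    symmetrization (m := m) (μ := nu P A σ) h0 (sum_nu hP) (clusterWeight P A σ)
  have hb : ∀ q : Fin m → {x // x ∈ P}, signExpect (fun e : Fin m → Bool => ⨆ j,
      |∑ i, sgn (e i) * clusterWeight P A σ j (q i)|) ≤
      (Real.log (2 * k) / (θ / (8 * k)) + θ / 4 * m) + θ / 4 * X q := by
    intro q
    have hs : ∀ j, ∑ i, clusterWeight P A σ j (q i) ^ 2 ≤ 4 * k * (m + X q) := by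
      intro j
      have h1 : ∑ i, clusterWeight P A σ j (q i) ^ 2 ≤
          4 * k * ∑ i, clusterWeight P A σ j (q i) := by
        rw [Finset.mul_sum]
        refine Finset.sum_le_sum fun i _ => ?_
        rw [pow_two]
        exact mul_le_mul_of_nonneg_right (clusterWeight_le j _) (clusterWeight_nonneg j _)
      have h2 : ∑ i, clusterWeight P A σ j (q i) ≤ m + X q := by
        have h3 := (abs_le.mp (abs_sum_le_iSup (fun j => ∑ i, clusterWeight P A σ j (q i) -
          m * ∑ p, nu P A σ p * clusterWeight P A σ j p) j)).2
        have h4 : ∑ p, nu P A σ p * clusterWeight P A σ j p ≤ 1 := by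
          rw [sum_nu_mul_clusterWeight]
          exact mul_div_le_left zero_le_one
        have h5 : (m : ℝ) * ∑ p, nu P A σ p * clusterWeight P A σ j p ≤ m * 1 :=
          mul_le_mul_of_nonneg_left h4 (Nat.cast_nonneg m)
        change _ ≤ X q at h3
        linarith
      exact h1.trans (mul_le_mul_of_nonneg_left h2 (by positivity))
    refine (massart (fun j i => clusterWeight P A σ j (q i)) _ _ hs (k : ℝ) ?_ le_rfl
      (θ / (8 * k)) (by positivity)).trans (le_of_eq ?_)
    · have : (Set.range fun (j : Fin k) i => clusterWeight P A σ j (q i)).ncard ≤ k := by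
        rw [← Set.image_univ]
        refine (Set.ncard_image_le (Set.toFinite _)).trans ?_
        rw [Set.ncard_univ, Nat.card_fin]
      exact_mod_cast this
    · field_simp
      ring
  have h1 := expect_mono (m := m) h0 hb
  rw [expect_add, expect_const (sum_nu hP), expect_const_mul] at h1
  have hlog : Real.log (2 * k) / (θ / (8 * k)) ≤ θ / 4 * m := by
    rw [div_le_iff₀ (by positivity), ← mul_div_assoc, le_div_iff₀ (by positivity)]
    nlinarith
  set EX := expect (nu P A σ) X
  have hEX : EX ≤ 2 * (θ / 4 * m + θ / 4 * m + θ / 4 * EX) := by linarith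
  have hEX0 : 0 ≤ EX := by
    have h := expect_mono (m := m) h0 (F := fun _ => 0) (G := X) fun q =>
      Real.iSup_nonneg fun _ => abs_nonneg _
    rwa [expect_const (sum_nu hP)] at h
  nlinarith

end Scores

/-! ### Failure events, and why avoiding them yields a coreset. -/

section Events

variable {d k m : ℕ} {P : Finset (Pt d)} {A : Fin k → Pt d} {σ : Pt d → Fin k}

open Classical in
/-- The probability of `B` under `m` independent draws from `nu`. -/
noncomputable def prob (P : Finset (Pt d)) (A : Fin k → Pt d) (σ : Pt d → Fin k) {m : ℕ}
    (B : Set (Fin m → {x // x ∈ P})) : ℝ :=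
  expect (nu P A σ) (fun q => if q ∈ B then 1 else 0)

theorem prob_mono {B B' : Set (Fin m → {x // x ∈ P})} (h : B ⊆ B') :
    prob P A σ B ≤ prob P A σ B' := by
  refine expect_mono (fun p => (nu_pos p).le) fun q => ?_
  by_cases h1 : q ∈ B
  · simp [h1, h h1]
  · by_cases h2 : q ∈ B' <;> simp [h1, h2]

theorem prob_empty : prob P A σ (∅ : Set (Fin m → {x // x ∈ P})) = 0 := by
  simp [prob, expect]

theorem prob_union_le (B B' : Set (Fin m → {x // x ∈ P})) :
    prob P A σ (B ∪ B') ≤ prob P A σ B + prob P A σ B' := by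
  unfold prob
  rw [← expect_add]
  refine expect_mono (fun p => (nu_pos p).le) fun q => ?_
  by_cases h1 : q ∈ B <;> by_cases h2 : q ∈ B' <;> simp [h1, h2]

theorem prob_biUnion_le {ι : Type*} (s : Finset ι) (B : ι → Set (Fin m → {x // x ∈ P})) :
    prob P A σ (⋃ i ∈ s, B i) ≤ ∑ i ∈ s, prob P A σ (B i) := by
  classical
  induction s using Finset.induction_on with
  | empty => simp [prob_empty]
  | insert i s hi ih =>
    rw [Finset.set_biUnion_insert, Finset.sum_insert hi]
    exact (prob_union_le _ _).trans (add_le_add le_rfl ih)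

theorem prob_mul_le {B : Set (Fin m → {x // x ∈ P})} {F : (Fin m → {x // x ∈ P}) → ℝ} {τ : ℝ}
    (hF : ∀ q, 0 ≤ F q) (hB : ∀ q ∈ B, τ ≤ F q) : prob P A σ B * τ ≤ expect (nu P A σ) F := by
  unfold prob
  rw [mul_comm, ← expect_const_mul]
  refine expect_mono (fun p => (nu_pos p).le) fun q => ?_
  by_cases h : q ∈ B
  · simpa [h] using hB q h
  · simpa [h] using hF q

theorem sampleLaw_real (hP : P.Nonempty) (G : Set (Fin m → {x // x ∈ P})) :
    (sampleLaw P hP A σ m).real G = prob P A σ G := by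
  classical
  have hs : ∀ q, (sampleLaw P hP A σ m).real {q} = ∏ i, nu P A σ (q i) := by
    intro q
    unfold sampleLaw
    rw [measureReal_def, Measure.pi_singleton, ENNReal.toReal_prod]
    refine Finset.prod_congr rfl fun i _ => ?_
    rw [PMF.toMeasure_apply_singleton _ _ (measurableSet_singleton _), samplingPMF,
      PMF.ofFintype_apply]
    exact ENNReal.toReal_ofReal (nu_pos (A := A) (σ := σ) (q i)).le
  have : IsProbabilityMeasure (sampleLaw P hP A σ m) := by
    unfold sampleLaw; infer_instance
  have h1 := sum_measureReal_singleton (μ := sampleLaw P hP A σ m) (Finset.univ.filter (· ∈ G))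
  have h2 : ((Finset.univ.filter (· ∈ G) : Finset (Fin m → {x // x ∈ P})) :
      Set (Fin m → {x // x ∈ P})) = G := by ext; simp
  rw [h2] at h1
  rw [← h1, Finset.sum_filter]
  unfold prob expect
  refine Finset.sum_congr rfl fun q _ => ?_
  rw [hs]
  by_cases hq : q ∈ G <;> simp [hq]

theorem two_thirds_le_of_prob_compl (hP : P.Nonempty) (G : Set (Fin m → {x // x ∈ P}))
    (h : prob P A σ Gᶜ ≤ 1 / 3) : 2 / 3 ≤ (sampleLaw P hP A σ m).real G := by
  rw [sampleLaw_real]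
  have h1 := prob_union_le (A := A) (σ := σ) G Gᶜ
  have h2 : prob P A σ (Set.univ : Set (Fin m → {x // x ∈ P})) = 1 := by
    simp only [prob, Set.mem_univ, if_true]
    exact expect_one (sum_nu hP)
  rw [Set.union_compl_self, h2] at h1
  linarith

/-- The samples for which some cluster size is not estimated up to a factor `1 ± η`. -/
def badSizes (P : Finset (Pt d)) (A : Fin k → Pt d) (σ : Pt d → Fin k) (m : ℕ) (η : ℝ) :
    Set (Fin m → {x // x ∈ P}) :=
  {q | η * m < ⨆ j, |∑ i, clusterWeight P A σ j (q i) -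
    m * ∑ p, nu P A σ p * clusterWeight P A σ j p|}

/-- The samples for which the relative costs are not well estimated for some solution in `𝒞`. -/
def badCosts (P : Finset (Pt d)) (A : Fin k → Pt d) (σ : Pt d → Fin k) (m : ℕ) (ε : ℝ)
    (𝒞 : Set (Fin k → Pt d)) : Set (Fin m → {x // x ∈ P}) :=
  {q | ∃ S ∈ 𝒞, m * (ε / 2) * cost P S <
    |∑ i, 1 / nu P A σ (q i) * relCost (A (σ (q i))) (q i) S -
      m * ∑ p ∈ P, relCost (A (σ p)) p S|}

/-- With θ = η/12 the mean deviation is at most ηm/6, and Markov's inequality applies. -/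
theorem prob_badSizes_le (hP : P.Nonempty) (hk : 1 ≤ k) (hm : 0 < m) {η : ℝ} (hη : 0 < η)
    (hη1 : η ≤ 1) (hηm : 32 * k * Real.log (2 * k) ≤ (η / 12) ^ 2 * m) :
    prob P A σ (badSizes P A σ m η) ≤ 1 / 6 := by
  have h1 := expect_clusterWeight_le (A := A) (σ := σ) hP hk (θ := η / 12) (by positivity)
    (by linarith) hηm
  have h2 := prob_mul_le (P := P) (A := A) (σ := σ) (B := badSizes P A σ m η) (τ := η * m)
    (F := fun q => ⨆ j, |∑ i, clusterWeight P A σ j (q i) -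
      m * ∑ p, nu P A σ p * clusterWeight P A σ j p|)
    (fun q => Real.iSup_nonneg fun _ => abs_nonneg _) (fun q hq => le_of_lt hq)
  have hmR : (0 : ℝ) < m := by exact_mod_cast hm
  have h3 : prob P A σ (badSizes P A σ m η) * (η * m) ≤ 1 / 6 * (η * m) := by linarith
  exact le_of_mul_le_mul_right h3 (by positivity)

/-- The class may be infinite, but there are finitely many samples. Choosing one violating solution
per bad sample gives a finite family indexed by the samples, to which `expect_relCost_le` and
Markov's inequality apply. -/
theorem prob_badCosts_le (hP : P.Nonempty) (hσ : IsNearest P A σ) (hA : 0 < cost P A)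
    (hk : 1 ≤ k) (hkm : k ≤ m) (x : ℕ) {ε K : ℝ} (hε : 0 < ε)
    (𝒞 : Set (Fin k → Pt d)) (hx : ∀ S ∈ 𝒞, (ambiguous A S).card ≤ x) (hK : ∀ S ∈ 𝒞, K ≤ cost P S)
    (H : ℕ) :
    prob P A σ (badCosts P A σ m ε 𝒞) * (m * (ε / 2) * K) ≤
      2 * (8 * H * (34 * (4 * cost P A)) *
        √(m * (132 * k * (1 + x) * (Real.log (3000 * m) + 2 * H))) +
          34 * (4 * cost P A) * m / 2 ^ H) := by
  classical
  rcases 𝒞.eq_empty_or_nonempty with rfl | ⟨S₀, hS₀⟩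
  · have : badCosts P A σ m ε ∅ = ∅ := by ext; simp [badCosts]
    rw [this, prob_empty, zero_mul]
    have : 0 ≤ 34 * (4 * cost P A) := by positivity
    positivity
  have hch : ∀ q : Fin m → {x // x ∈ P}, ∃ S ∈ 𝒞, q ∈ badCosts P A σ m ε 𝒞 →
      m * (ε / 2) * cost P S < |∑ i, 1 / nu P A σ (q i) * relCost (A (σ (q i))) (q i) S -
        m * ∑ p ∈ P, relCost (A (σ p)) p S| := by
    intro q
    by_cases hq : q ∈ badCosts P A σ m ε 𝒞
    · obtain ⟨S, hS, h⟩ := hq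
      exact ⟨S, hS, fun _ => h⟩
    · exact ⟨S₀, hS₀, fun h => absurd h hq⟩
  choose S hS hbad using hch
  have : Nonempty (Fin m → {x // x ∈ P}) := ⟨fun _ => ⟨hP.choose, hP.choose_spec⟩⟩
  refine le_trans ?_ (expect_relCost_le hP hσ hA hk hkm x S (fun q => hx _ (hS q)) H)
  refine prob_mul_le (fun q => Real.iSup_nonneg fun _ => abs_nonneg _) fun q hq => ?_
  have h1 := abs_sum_le_iSup (fun t => ∑ i, 1 / nu P A σ (q i) * relCost (A (σ (q i))) (q i) (S t) -
        m * ∑ p ∈ P, relCost (A (σ p)) p (S t)) q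
  have h2 : (m : ℝ) * (ε / 2) * K ≤ m * (ε / 2) * cost P (S q) :=
    mul_le_mul_of_nonneg_left (hK _ (hS q)) (by positivity)
  exact h2.trans ((hbad q hq).le.trans h1)

theorem sum_ptCost_center_eq (S : Fin k → Pt d) :
    ∑ p ∈ P, ptCost (A (σ p)) S = ∑ j, (cluster P σ j).card * ptCost (A j) S := by
  rw [← sum_cluster P σ]
  refine Finset.sum_congr rfl fun j _ => ?_
  rw [Finset.sum_congr rfl fun p hp => by rw [eq_of_mem_cluster hp], Finset.sum_const, nsmul_eq_mul]

theorem sum_ptCost_center_le (hσ : IsNearest P A σ) (S : Fin k → Pt d) :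
    ∑ p ∈ P, ptCost (A (σ p)) S ≤ cost P S + cost P A := by
  unfold cost
  rw [← Finset.sum_add_distrib]
  refine Finset.sum_le_sum fun p hp => ?_
  have : NeZero k := ⟨by have := (σ p).pos; omega⟩
  have h := ptCost_le_add (A (σ p)) p S
  rw [dist_comm, ← ptCost_eq_of_isNearest hσ hp] at h
  linarith

/-- The errors in the relative costs and in the cluster sizes contribute (ε/2) cost(P, S) each. For
the sizes, η (1+γ) = ε/2, where 1 + γ bounds the total cost of the centers a_p relative to cost(P,
S). -/
theorem isCoreset_of_notMem (hσ : IsNearest P A σ) (hm : 0 < m) {ε γ : ℝ} (hε : 0 < ε) (hγ : 1 ≤ γ)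
    (hA : IsApprox γ P A) {q : Fin m → {x // x ∈ P}}
    (h1 : q ∉ badSizes P A σ m (ε / (2 * (1 + γ)))) (h2 : q ∉ badCosts P A σ m ε Set.univ) :
    IsCoreset P k ε (fun i => (q i : Pt d)) (fun i => sampleWeight P A σ m (q i)) := by
  intro S
  have hmR : (0 : ℝ) < m := by exact_mod_cast hm
  set η := ε / (2 * (1 + γ)) with hη
  have hη0 : 0 < η := by positivity
  have hrel : |∑ i, 1 / nu P A σ (q i) * relCost (A (σ (q i))) (q i) S -
      m * ∑ p ∈ P, relCost (A (σ p)) p S| ≤ m * (ε / 2) * cost P S := by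
    by_contra hcon
    exact h2 ⟨S, Set.mem_univ _, not_le.mp hcon⟩
  have hX : (⨆ j, |∑ i, clusterWeight P A σ j (q i) -
      m * ∑ p, nu P A σ p * clusterWeight P A σ j p|) ≤ η * m := not_lt.mp h1
  have hW : ∀ i, 1 / nu P A σ (q i) * ptCost (A (σ (q i))) S =
      ∑ j, (cluster P σ j).card * ptCost (A j) S * clusterWeight P A σ j (q i) := by
    intro i
    rw [Finset.sum_eq_single (σ (q i))]
    · have := (card_cluster_pos (σ := σ) (q i).2).ne'
      simp only [clusterWeight, if_true]
      field_simp
    · intro j _ hj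
      simp [clusterWeight, hj.symm]
    · simp
  have hsz : |∑ i, 1 / nu P A σ (q i) * ptCost (A (σ (q i))) S -
      m * ∑ p ∈ P, ptCost (A (σ p)) S| ≤ m * (ε / 2) * cost P S := by
    have e : ∑ i, 1 / nu P A σ (q i) * ptCost (A (σ (q i))) S - m * ∑ p ∈ P, ptCost (A (σ p)) S =
        ∑ j, (cluster P σ j).card * ptCost (A j) S * (∑ i, clusterWeight P A σ j (q i) -
          m * ∑ p, nu P A σ p * clusterWeight P A σ j p) := by
      rw [sum_ptCost_center_eq]
      simp only [hW, mul_sub, Finset.sum_sub_distrib, sum_nu_mul_clusterWeight]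
      rw [Finset.sum_comm, Finset.mul_sum]
      simp only [Finset.mul_sum]
      congr 1
      refine Finset.sum_congr rfl fun j _ => ?_
      rcases eq_or_ne ((cluster P σ j).card : ℝ) 0 with h0 | h0
      · simp [h0]
      · field_simp
    rw [e]
    refine (Finset.abs_sum_le_sum_abs _ _).trans ?_
    calc _ ≤ ∑ j, (cluster P σ j).card * ptCost (A j) S * (η * m) := by
          refine Finset.sum_le_sum fun j _ => ?_
          have h0 : 0 ≤ (cluster P σ j).card * ptCost (A j) S :=
            mul_nonneg (Nat.cast_nonneg _) (ptCost_nonneg _ _)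
          rw [abs_mul, abs_of_nonneg h0]
          refine mul_le_mul_of_nonneg_left (le_trans ?_ hX) h0
          exact abs_sum_le_iSup (fun j => ∑ i, clusterWeight P A σ j (q i) -
            m * ∑ p, nu P A σ p * clusterWeight P A σ j p) j
      _ = (∑ p ∈ P, ptCost (A (σ p)) S) * (η * m) := by
          rw [← Finset.sum_mul, sum_ptCost_center_eq]
      _ ≤ ((1 + γ) * cost P S) * (η * m) := by
          refine mul_le_mul_of_nonneg_right ?_ (by positivity)
          have b1 := sum_ptCost_center_le hσ S
          have b2 : cost P A ≤ γ * cost P S :=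
            le_trans hA (mul_le_mul_of_nonneg_left (opt_le_cost P S) (by linarith))
          linarith
      _ = m * (ε / 2) * cost P S := by
          rw [hη]; field_simp
  have etot : m * (∑ i, sampleWeight P A σ m (q i) * ptCost (q i : Pt d) S - cost P S) =
      (∑ i, 1 / nu P A σ (q i) * relCost (A (σ (q i))) (q i) S -
        m * ∑ p ∈ P, relCost (A (σ p)) p S) +
      (∑ i, 1 / nu P A σ (q i) * ptCost (A (σ (q i))) S - m * ∑ p ∈ P, ptCost (A (σ p)) S) := by
    simp only [relCost, mul_sub, Finset.sum_sub_distrib]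
    have : ∀ i, (m : ℝ) * (sampleWeight P A σ m (q i) * ptCost (q i : Pt d) S) =
        1 / nu P A σ (q i) * ptCost (q i : Pt d) S := by
      intro i
      have h := (nu_pos (A := A) (σ := σ) (q i)).ne'
      change mu P A σ (q i) ≠ 0 at h
      simp only [sampleWeight, nu]
      field_simp
    rw [Finset.mul_sum]
    simp only [this]
    unfold cost
    ring
  have habs : |(m : ℝ) * (∑ i, sampleWeight P A σ m (q i) * ptCost (q i : Pt d) S - cost P S)| ≤
      m * (ε * cost P S) := by
    rw [etot]
    refine (abs_add_le _ _).trans ?_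
    linarith
  rw [abs_mul, abs_of_pos hmR] at habs
  have := abs_le.mp (le_of_mul_le_mul_left habs hmR)
  constructor <;> linarith [this.1, this.2]

end Events

/-! ### Arithmetic of the sample size. -/

section Arithmetic

theorem log_le_two_mul_sqrt {y : ℝ} (hy : 0 < y) : Real.log y ≤ 2 * √y := by
  have h := Real.log_le_sub_one_of_pos (Real.sqrt_pos.mpr hy)
  rw [Real.log_sqrt hy.le] at h
  linarith

/-- Solving `m ≥ W (log m + c)` for `m`. -/
theorem mul_log_add_le {W m c B : ℝ} (hW : 0 < W) (hB : 0 ≤ B) (hc : 0 ≤ c) (hWB : Real.log W ≤ B)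
    (hm : W * (16 + 2 * (B + c)) ≤ m) : W * (Real.log m + c) ≤ m := by
  -- In terms of y, log y ≤ 2√y ≤ y/2 once y ≥ 16, and the other half of y pays for B + c.
  set y := m / W with hy
  have hmy : m = W * y := by rw [hy]; field_simp
  have hy16 : 16 + 2 * (B + c) ≤ y := by
    rw [hy, le_div_iff₀ hW]; linarith
  have hypos : 0 < y := by linarith
  have hlog : Real.log m = Real.log W + Real.log y := by
    rw [hmy, Real.log_mul hW.ne' hypos.ne']
  have hs := log_le_two_mul_sqrt hypos
  have hsq : 4 * √y ≤ y := by
    have h4 : 4 ≤ √y := Real.le_sqrt_of_sq_le (by linarith)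
    nlinarith [Real.mul_self_sqrt hypos.le]
  rw [hlog, hmy]
  refine mul_le_mul_of_nonneg_left ?_ hW.le
  linarith

theorem le_two_pow_ceil {z : ℝ} (hz : 1 ≤ z) : z ≤ 2 ^ ⌈2 * Real.log z⌉₊ := by
  have h1 : (0 : ℝ) ≤ Real.log z := Real.log_nonneg hz
  have h2 := Nat.le_ceil (2 * Real.log z)
  have h3 := Real.log_two_gt_d9
  rw [← Real.log_le_log_iff (by linarith) (by positivity), Real.log_pow]
  nlinarith

theorem log_scale {k ε : ℝ} (hk : 1 ≤ k) (hε : 0 < ε) (hε1 : ε < 1) :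
    1 ≤ 1 + Real.log (k / ε) ∧ Real.log k ≤ Real.log (k / ε) ∧ -Real.log ε ≤ Real.log (k / ε) := by
  have h1 := Real.log_nonneg hk
  have h2 := Real.log_nonpos hε.le hε1.le
  rw [Real.log_div (by linarith) hε.ne']
  refine ⟨by linarith, by linarith, by linarith⟩

theorem natLog_add_one_le {k : ℕ} (hk : 1 ≤ k) :
    ((Nat.log 2 (k + 1) + 1 : ℕ) : ℝ) ≤ 2 * (1 + Real.log k) := by
  have h1 : Nat.log 2 (k + 1) * Real.log 2 ≤ Real.log 2 + Real.log k := by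
    have hk' : (1 : ℝ) ≤ k := by exact_mod_cast hk
    rw [← Real.log_pow, ← Real.log_mul (by norm_num) (by positivity)]
    refine Real.log_le_log (by positivity) ?_
    have h := Nat.pow_log_le_self 2 (show k + 1 ≠ 0 by omega)
    have h' : ((2 ^ Nat.log 2 (k + 1) : ℕ) : ℝ) ≤ ((k + 1 : ℕ) : ℝ) := by exact_mod_cast h
    push_cast at h'
    linarith
  have h2 := Real.log_two_gt_d9
  have h3 : 0 ≤ Real.log k := Real.log_natCast_nonneg k
  push_cast
  have h4 : ((Nat.log 2 (k + 1) : ℝ) - 1 - 2 * Real.log k) * Real.log 2 ≤ 0 := by nlinarith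
  have h5 : (Nat.log 2 (k + 1) : ℝ) - 1 - 2 * Real.log k ≤ 0 := by
    by_contra hcon
    have := mul_pos (not_le.mp hcon) (by linarith : 0 < Real.log 2)
    linarith
  linarith

theorem log_three_thousand_le : Real.log 3000 ≤ 9 := by
  have h1 : Real.log 3000 ≤ Real.log (2 ^ 12) := Real.log_le_log (by norm_num) (by norm_num)
  rw [Real.log_pow] at h1
  have := Real.log_two_lt_d9
  push_cast at h1
  linarith

/-- The number of ambiguous clusters against the growth of the cost that it forces. -/
theorem two_pow_le_mul_sq {β D : ℝ} (hβ : 0 < β) (hD : 1 ≤ D) (l : ℕ) :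
    (2 : ℝ) ^ l ≤ 2 * D * max 1 (1 / β) * (max 1 ((2 ^ l - 1) * (β / D))) ^ 2 := by
  set M := max 1 (((2 : ℝ) ^ l - 1) * (β / D)) with hM
  have hM1 : 1 ≤ M := le_max_left _ _
  have hv : 1 ≤ max 1 (1 / β) := le_max_left _ _
  have hMM : M ≤ M ^ 2 := by nlinarith
  have hprod : 1 ≤ max 1 (1 / β) * M ^ 2 := one_le_mul_of_one_le_of_one_le hv (by linarith)
  rcases Nat.eq_zero_or_pos l with rfl | hl
  · rw [pow_zero]
    nlinarith
  · have h2 : (2 : ℝ) ≤ 2 ^ l := by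
      calc (2 : ℝ) = 2 ^ 1 := by norm_num
        _ ≤ 2 ^ l := pow_le_pow_right₀ (by norm_num) hl
    have h3 : (2 : ℝ) ^ l ≤ 2 * (2 ^ l - 1) := by linarith
    have h4 : ((2 : ℝ) ^ l - 1) * (β / D) ≤ M := le_max_right _ _
    have h5 : (2 : ℝ) ^ l - 1 ≤ D * (1 / β) * M := by
      calc (2 : ℝ) ^ l - 1 = D * (1 / β) * ((2 ^ l - 1) * (β / D)) := by field_simp
        _ ≤ _ := by gcongr
    calc (2 : ℝ) ^ l ≤ 2 * (2 ^ l - 1) := h3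
      _ ≤ 2 * (D * (1 / β) * M) := by linarith
      _ ≤ 2 * (D * max 1 (1 / β) * M ^ 2) := by gcongr; exact le_max_right _ _
      _ = _ := by ring

/-- The constant 13056 = 34 * 4 * 96 makes the truncation term of the chaining small enough for
`deviation_le`, while H stays logarithmic in k/ε. -/
theorem exists_level {γ : ℝ} (hγ : 1 ≤ γ) {k : ℕ} (hk : 1 ≤ k) {ε : ℝ} (hε : 0 < ε) (hε1 : ε < 1) :
    ∃ H : ℕ, 13056 * γ * (1 + Real.log (k / ε)) / ε ≤ 2 ^ H ∧
      (H : ℝ) ≤ (2 * Real.log (13056 * γ) + 5) * (1 + Real.log (k / ε)) := by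
  have hkR : (1 : ℝ) ≤ k := by exact_mod_cast hk
  obtain ⟨hL, -, hεL⟩ := log_scale hkR hε hε1
  set L := 1 + Real.log (k / ε) with hLdef
  have hg : 1 ≤ 13056 * γ := by linarith
  have hgl := Real.log_nonneg hg
  have hz : 1 ≤ 13056 * γ * L / ε := by
    rw [le_div_iff₀ hε]
    nlinarith
  refine ⟨_, le_two_pow_ceil hz, ?_⟩
  have h1 := Nat.ceil_lt_add_one (a := 2 * Real.log (13056 * γ * L / ε))
    (mul_nonneg zero_le_two (Real.log_nonneg hz))
  have h2 : Real.log (13056 * γ * L / ε) = Real.log (13056 * γ) + Real.log L - Real.log ε := by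
    rw [Real.log_div (by positivity) hε.ne', Real.log_mul (by positivity) (by positivity)]
  have h3 := Real.log_le_sub_one_of_pos (show 0 < L by linarith)
  have h4 : Real.log (13056 * γ) ≤ Real.log (13056 * γ) * L := le_mul_of_one_le_right hgl hL
  linarith

/-- The levels and the truncation term receive m ε M / (96 L) each, whence 104448 = 8 * 34 * 4 * 96.
-/
theorem deviation_le {γ ε L M Λ b m : ℝ} {H : ℕ} (hγ : 1 ≤ γ) (hε : 0 < ε) (hL : 1 ≤ L)
    (hM : 1 ≤ M) (hm : 0 < m) (hb : 1 ≤ b) (hHb : (H : ℝ) ≤ b * L) (hH : 13056 * γ * L / ε ≤ 2 ^ H)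
    (hΛ : (104448 * γ * b * L ^ 2) ^ 2 * Λ ≤ m * (ε * M) ^ 2) :
    2 * (8 * H * (34 * (4 * γ)) * √(m * Λ) + 34 * (4 * γ) * m / 2 ^ H) ≤
      m * (ε / 2) * M / (12 * L) := by
  have h1 : √(m * Λ) ≤ m * (ε * M) / (104448 * γ * b * L ^ 2) := by
    refine Real.sqrt_le_iff.mpr ⟨by positivity, ?_⟩
    rw [div_pow, le_div_iff₀ (by positivity)]
    nlinarith
  have h2 : 8 * H * (34 * (4 * γ)) * √(m * Λ) ≤ m * ε * M / (96 * L) := by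
    calc 8 * H * (34 * (4 * γ)) * √(m * Λ)
        ≤ 8 * (b * L) * (34 * (4 * γ)) * (m * (ε * M) / (104448 * γ * b * L ^ 2)) := by gcongr
      _ = m * ε * M / (96 * L) := by field_simp; norm_num
  have h3 : 34 * (4 * γ) * m / 2 ^ H ≤ m * ε * M / (96 * L) := by
    calc 34 * (4 * γ) * m / 2 ^ H ≤ 34 * (4 * γ) * m / (13056 * γ * L / ε) := by gcongr
      _ = m * ε * 1 / (96 * L) := by field_simp; norm_num
      _ ≤ _ := by gcongr
  calc _ ≤ 2 * (m * ε * M / (96 * L) + m * ε * M / (96 * L)) := by linarith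
    _ = _ := by field_simp; norm_num

theorem size_condition {γ ε k L m c : ℝ} (hγ : 1 ≤ γ) (hε : 0 < ε) (hk : 1 ≤ k) (hL : 1 ≤ L)
    (hkL : 1 + Real.log k ≤ L) (hc : 73728 * γ ^ 2 ≤ c) (hm : c * (k / ε ^ 2) * L ≤ m) :
    32 * k * Real.log (2 * k) ≤ (ε / (2 * (1 + γ)) / 12) ^ 2 * m := by
  have hlog : Real.log (2 * k) ≤ L := by
    rw [Real.log_mul (by norm_num) (by linarith)]
    have := Real.log_two_lt_d9
    linarith
  have hγ4 : (1 + γ) ^ 2 ≤ 4 * γ ^ 2 := by nlinarith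
  have h1 : 32 * k * L * (24 * (1 + γ)) ^ 2 ≤ ε ^ 2 * m := by
    calc 32 * k * L * (24 * (1 + γ)) ^ 2 = 18432 * (1 + γ) ^ 2 * (k * L) := by ring
      _ ≤ 18432 * (4 * γ ^ 2) * (k * L) := by gcongr
      _ = 73728 * γ ^ 2 * (k * L) := by ring
      _ ≤ c * (k * L) := by gcongr
      _ = ε ^ 2 * (c * (k / ε ^ 2) * L) := by field_simp
      _ ≤ ε ^ 2 * m := by gcongr
  have e : (ε / (2 * (1 + γ)) / 12) ^ 2 * m = ε ^ 2 * m / (24 * (1 + γ)) ^ 2 := by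
    field_simp; ring
  rw [e, le_div_iff₀ (by positivity)]
  refine le_trans ?_ h1
  gcongr

/-- The bound v ≤ 2k keeps 1/β out of the logarithm. -/
theorem log_width_le {c k ε v : ℝ} (hc : 1 ≤ c) (hk : 1 ≤ k) (hε : 0 < ε) (hε1 : ε < 1)
    (hv : 1 ≤ v) (hvk : v ≤ 2 * k) :
    Real.log (c * (k / ε ^ 2) * v * (1 + Real.log (k / ε)) ^ 4) ≤
      (Real.log c + 9) * (1 + Real.log (k / ε)) := by
  obtain ⟨hL, hkL, hεL⟩ := log_scale hk hε hε1
  have e0 : Real.log (k / ε) = Real.log k - Real.log ε := Real.log_div (by positivity) hε.ne'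
  set L := 1 + Real.log (k / ε) with hLdef
  have hlc := Real.log_nonneg hc
  have e : Real.log (c * (k / ε ^ 2) * v * L ^ 4) =
      Real.log c + Real.log (k / ε ^ 2) + Real.log v + 4 * Real.log L := by
    rw [Real.log_mul (by positivity) (by positivity), Real.log_mul (by positivity)
      (by positivity), Real.log_mul (by positivity) (by positivity), Real.log_pow]
    norm_num
  have e1 : Real.log (k / ε ^ 2) ≤ 2 * L := by
    rw [Real.log_div (by positivity) (by positivity), Real.log_pow]
    have := Real.log_nonneg hk
    push_cast
    linarith
  have e2 : Real.log v ≤ 1 + L := by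
    have h : Real.log v ≤ Real.log (2 * k) := Real.log_le_log (by linarith) hvk
    rw [Real.log_mul (by norm_num) (by linarith)] at h
    have := Real.log_two_lt_d9
    linarith
  have e3 := Real.log_le_sub_one_of_pos (show 0 < L by linarith)
  have e4 : Real.log c ≤ Real.log c * L := le_mul_of_one_le_right hlc hL
  rw [e]
  linarith

/-- The arithmetic of the sample size. -/
theorem exists_sample_size_constant {γ D : ℝ} (hγ : 1 ≤ γ) (hD : 1 ≤ D) :
    ∃ C : ℝ, 0 < C ∧ ∀ (k m : ℕ) (β ε : ℝ), 1 ≤ k → 0 < β → 0 < ε → ε < 1 →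
      C * ((k : ℝ) / ε ^ 2 * max 1 (1 / β)) * (1 + Real.log ((k : ℝ) / ε)) ^ 5 ≤ (m : ℝ) →
      k ≤ m ∧ 32 * k * Real.log (2 * k) ≤ (ε / (2 * (1 + γ)) / 12) ^ 2 * m ∧
      ∃ H : ℕ, ∀ l : ℕ, 2 ^ l ≤ k + 1 →
        2 * (8 * H * (34 * (4 * γ)) *
          √(m * (132 * k * (1 + (2 ^ (l + 1) : ℕ)) * (Real.log (3000 * m) + 2 * H))) +
            34 * (4 * γ) * m / 2 ^ H) ≤
          m * (ε / 2) * max 1 ((2 ^ l - 1) * (β / D)) / (6 * (Nat.log 2 (k + 1) + 1 : ℕ)) := by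
  set b := 2 * Real.log (13056 * γ) + 5 with hb
  have hb1 : 5 ≤ b := by
    have := Real.log_nonneg (show 1 ≤ 13056 * γ by linarith)
    linarith
  clear_value b
  set c₂ := 9 + 2 * b with hc₂
  -- Here 396 = 132 * 3, from the code count and 1 + 2^(l+1) ≤ 3 * 2^l; the square is the one in
  -- `deviation_le`.
  set c₄ := 396 * (104448 * γ * b) ^ 2 with hc₄
  have hc₄γ : 73728 * γ ^ 2 ≤ c₄ := by
    have e : c₄ = 396 * 104448 ^ 2 * (γ ^ 2 * b ^ 2) := by rw [hc₄]; ring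
    have : γ ^ 2 * 1 ≤ γ ^ 2 * b ^ 2 := by gcongr; nlinarith
    rw [e]; nlinarith [sq_nonneg γ]
  have hc₄1 : 73728 ≤ c₄ := by nlinarith
  set c₅ := Real.log c₄ + 9 with hc₅
  have hlc₄ := Real.log_nonneg (show 1 ≤ c₄ by linarith)
  set F := 16 + 2 * (c₅ + c₂) with hF
  have hF1 : 1 ≤ F := by linarith
  -- The exponent 5 consists of L^4, the square of the L^2 in `deviation_le`, and one more L for the
  -- logarithm of m.
  refine ⟨c₄ * (2 * D) * F, by positivity, fun k m β ε hk hβ hε hε1 hm => ?_⟩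
  have hkR : (1 : ℝ) ≤ k := by exact_mod_cast hk
  obtain ⟨hL, hkL, hεL⟩ := log_scale hkR hε hε1
  set L := 1 + Real.log (k / ε) with hLdef
  set B := max 1 (1 / β) with hB
  have hB1 : 1 ≤ B := le_max_left _ _
  have hε2 : ε ^ 2 ≤ 1 := by nlinarith
  have hkε : k ≤ (k : ℝ) / ε ^ 2 := by
    rw [le_div_iff₀ (by positivity)]; nlinarith
  -- Truncating at k + 1 keeps log W of order L however small β is. It is harmless because only
  -- levels with 2^l ≤ k + 1 occur.
  set v : ℝ := min (2 * D * B) (k + 1) with hv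
  have hv1 : 1 ≤ v := le_min (by nlinarith) (by linarith)
  set W := c₄ * (k / ε ^ 2) * v * L ^ 4 with hW
  have hL4 : 1 ≤ L ^ 4 := one_le_pow₀ hL
  have hWpos : 0 < W := by positivity
  have hWm : W * (F * L) ≤ m := by
    refine le_trans ?_ hm
    calc W * (F * L) ≤ (c₄ * (k / ε ^ 2) * (2 * D * B) * L ^ 4) * (F * L) := by
          rw [hW]; gcongr; exact min_le_left _ _
      _ = _ := by ring
  have hbase : c₄ * (k / ε ^ 2) * L ≤ m := by
    refine le_trans ?_ hWm
    have h1 : c₄ * (k / ε ^ 2) ≤ W := by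
      calc c₄ * (k / ε ^ 2) = c₄ * (k / ε ^ 2) * 1 * 1 := by ring
        _ ≤ W := by rw [hW]; gcongr
    have h2 : L ≤ F * L := le_mul_of_one_le_left (by linarith) hF1
    gcongr
  have hkm : (k : ℝ) ≤ m := by
    refine le_trans ?_ hbase
    calc (k : ℝ) = 1 * k * 1 := by ring
      _ ≤ c₄ * (k / ε ^ 2) * L := by gcongr; linarith
  have hmpos : (0 : ℝ) < m := by linarith
  refine ⟨by exact_mod_cast hkm, ?_, ?_⟩
  · exact size_condition hγ hε hkR hL (by linarith) hc₄γ hbase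
  obtain ⟨H, hH, hHb⟩ := exists_level hγ hk hε hε1
  rw [← hb, ← hLdef] at hHb
  refine ⟨H, fun l hl => ?_⟩
  set M := max 1 (((2 : ℝ) ^ l - 1) * (β / D)) with hM
  have hM1 : 1 ≤ M := le_max_left _ _
  have hlv : (2 : ℝ) ^ l ≤ v * M ^ 2 := by
    have hM2 : 1 ≤ M ^ 2 := one_le_pow₀ hM1
    rw [hv, min_mul_of_nonneg _ _ (by positivity)]
    refine le_min (two_pow_le_mul_sq hβ hD l) ?_
    have h : (2 : ℝ) ^ l ≤ k + 1 := by exact_mod_cast hl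
    exact h.trans (le_mul_of_one_le_right (by positivity) hM2)
  have hlogm : W * (Real.log m + c₂ * L) ≤ m := by
    refine mul_log_add_le (B := c₅ * L) hWpos (by positivity) (by positivity) ?_ ?_
    · exact log_width_le (by linarith) hkR hε hε1 hv1 ((min_le_right _ _).trans (by linarith))
    · refine le_trans (mul_le_mul_of_nonneg_left ?_ hWpos.le) hWm
      calc 16 + 2 * (c₅ * L + c₂ * L) ≤ 16 * L + 2 * (c₅ * L + c₂ * L) := by linarith
        _ = F * L := by rw [hF]; ring
  have hdev := deviation_le (b := b) (L := L) (M := M) (ε := ε) (m := m) (H := H)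
    (Λ := 132 * k * (1 + (2 ^ (l + 1) : ℕ)) * (Real.log (3000 * m) + 2 * H)) hγ hε hL hM1 hmpos
    (by linarith) hHb hH (by
      have h1 : (1 + (2 ^ (l + 1) : ℕ) : ℝ) ≤ 3 * 2 ^ l := by
        push_cast
        rw [pow_succ]
        have : (1 : ℝ) ≤ 2 ^ l := one_le_pow₀ (by norm_num)
        linarith
      have hlm : 0 ≤ Real.log m := Real.log_nonneg (by linarith)
      have h2 : Real.log (3000 * m) + 2 * H ≤ Real.log m + c₂ * L := by
        rw [Real.log_mul (by norm_num) hmpos.ne']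
        have := log_three_thousand_le
        have : c₂ * L = 9 * L + 2 * (b * L) := by rw [hc₂]; ring
        linarith
      have h0 : 0 ≤ Real.log (3000 * m) + 2 * H :=
        add_nonneg (Real.log_nonneg (by linarith)) (by positivity)
      have h3 : (1 + (2 ^ (l + 1) : ℕ) : ℝ) ≤ 3 * (v * M ^ 2) := by linarith
      calc (104448 * γ * b * L ^ 2) ^ 2 *
            (132 * k * (1 + (2 ^ (l + 1) : ℕ)) * (Real.log (3000 * m) + 2 * H))
          ≤ (104448 * γ * b * L ^ 2) ^ 2 *
            (132 * k * (3 * (v * M ^ 2)) * (Real.log m + c₂ * L)) := by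
              gcongr
        _ = ε ^ 2 * M ^ 2 * (W * (Real.log m + c₂ * L)) := by
              rw [hW, hc₄]; field_simp; ring
        _ ≤ ε ^ 2 * M ^ 2 * m := by gcongr
        _ = _ := by ring)
  refine hdev.trans ?_
  have hN : ((Nat.log 2 (k + 1) + 1 : ℕ) : ℝ) ≤ 2 * L := (natLog_add_one_le hk).trans (by linarith)
  have hN0 : (0 : ℝ) < (Nat.log 2 (k + 1) + 1 : ℕ) := by positivity
  refine div_le_div_of_nonneg_left (by positivity) (by positivity) ?_
  linarith

end Arithmetic

/-! ### Union bound over dyadic classes of ambiguity, and the theorem. -/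

section Main

variable {d k m : ℕ} {P : Finset (Pt d)} {A : Fin k → Pt d} {σ : Pt d → Fin k}

theorem relCost_eq_zero (hσ : IsNearest P A σ) (h0 : cost P A = 0) {p : Pt d} (hp : p ∈ P)
    (S : Fin k → Pt d) : relCost (A (σ p)) p S = 0 := by
  have : NeZero k := ⟨by have := (σ p).pos; omega⟩
  have h1 : ptCost p A ≤ cost P A :=
    Finset.single_le_sum (f := fun p => ptCost p A) (fun x _ => ptCost_nonneg x A) hp
  have h2 := abs_relCost_le (A (σ p)) p S
  rw [← ptCost_eq_of_isNearest hσ hp] at h2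
  exact abs_nonpos_iff.mp (h2.trans (by linarith))

/-- The cost of a solution whose number of ambiguous clusters is at least `2 ^ l - 1`. -/
theorem opt_mul_max_le_cost {γ β : ℝ} (hγ : 1 ≤ γ) (hβ : 0 < β) (hst : IsStable P k β)
    (hσ : IsNearest P A σ) (hA : IsApprox γ P A) (S : Fin k → Pt d) {l : ℕ}
    (hl : 2 ^ l ≤ (ambiguous A S).card + 1) :
    opt P k * max 1 ((2 ^ l - 1) * (β / (8 * (3 + 4 * γ)))) ≤ cost P S := by
  have hopt := opt_le_cost P S
  have hopt0 := opt_nonneg P k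
  have h1 := card_ambiguous_mul_opt_le hst hσ S
  have hA' : cost P A ≤ γ * cost P S := le_trans hA (mul_le_mul_of_nonneg_left hopt (by linarith))
  rw [mul_max_of_nonneg _ _ hopt0, mul_one]
  refine max_le hopt ?_
  have hl' : (2 : ℝ) ^ l - 1 ≤ (ambiguous A S).card := by
    have : ((2 ^ l : ℕ) : ℝ) ≤ (((ambiguous A S).card + 1 : ℕ) : ℝ) := by exact_mod_cast hl
    push_cast at this
    linarith
  have e : opt P k * ((2 ^ l - 1) * (β / (8 * (3 + 4 * γ)))) =
      (2 ^ l - 1) * (β * opt P k) / (8 * (3 + 4 * γ)) := by field_simp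
  rw [e, div_le_iff₀ (by positivity)]
  have h2 : ((2 : ℝ) ^ l - 1) * (β * opt P k) ≤ (ambiguous A S).card * (β * opt P k) := by gcongr
  linarith

/-- The solutions whose number of ambiguous clusters is of the order of `2 ^ l`. -/
def ambiguityClass (A : Fin k → Pt d) (l : ℕ) : Set (Fin k → Pt d) :=
  {S | Nat.log 2 ((ambiguous A S).card + 1) = l}

theorem badCosts_univ_subset (ε : ℝ) :
    badCosts P A σ m ε Set.univ ⊆
      ⋃ l ∈ Finset.range (Nat.log 2 (k + 1) + 1), badCosts P A σ m ε (ambiguityClass A l) := by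
  rintro q ⟨S, -, hS⟩
  simp only [Set.mem_iUnion]
  refine ⟨Nat.log 2 ((ambiguous A S).card + 1), Finset.mem_range.mpr ?_, S, rfl, hS⟩
  have h : (ambiguous A S).card ≤ k := by simpa using Finset.card_le_univ (ambiguous A S)
  have := Nat.log_mono_right (b := 2) (show (ambiguous A S).card + 1 ≤ k + 1 by omega)
  omega

theorem prob_badCosts_univ_le (hP : P.Nonempty) (hσ : IsNearest P A σ) {γ β ε : ℝ} (hγ : 1 ≤ γ)
    (hβ : 0 < β) (hε : 0 < ε) (hst : IsStable P k β) (hA : IsApprox γ P A) (hk : 1 ≤ k) (hkm : k ≤ m)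
    (H : ℕ)
    (hH : ∀ l : ℕ, 2 ^ l ≤ k + 1 →
        2 * (8 * H * (34 * (4 * γ)) *
          √(m * (132 * k * (1 + (2 ^ (l + 1) : ℕ)) * (Real.log (3000 * m) + 2 * H))) +
            34 * (4 * γ) * m / 2 ^ H) ≤
          m * (ε / 2) * max 1 ((2 ^ l - 1) * (β / (8 * (3 + 4 * γ)))) /
            (6 * (Nat.log 2 (k + 1) + 1 : ℕ))) :
    prob P A σ (badCosts P A σ m ε Set.univ) ≤ 1 / 6 := by
  -- If cost(P, A) = 0, every point of P is its own center and all relative costs vanish, so no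
  -- sample is bad.
  rcases (cost_nonneg P A).eq_or_lt with h0 | hcA
  · have : badCosts P A σ m ε Set.univ = ∅ := by
      rw [Set.eq_empty_iff_forall_notMem]
      rintro q ⟨S, -, hS⟩
      have e1 : ∀ i, relCost (A (σ (q i))) (q i : Pt d) S = 0 :=
        fun i => relCost_eq_zero hσ h0.symm (q i).2 S
      have e2 : ∑ p ∈ P, relCost (A (σ p)) p S = 0 :=
        Finset.sum_eq_zero fun p hp => relCost_eq_zero hσ h0.symm hp S
      simp only [e1, e2, mul_zero, Finset.sum_const_zero, sub_zero, abs_zero] at hS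
      have := cost_nonneg P S
      exact absurd hS (not_lt.mpr (by positivity))
    rw [this, prob_empty]
    norm_num
  have hopt : 0 < opt P k := by
    have h := hcA.trans_le hA
    exact pos_of_mul_pos_right h (by linarith)
  have hmpos : (0 : ℝ) < m := by exact_mod_cast (show 0 < m by omega)
  set N := Nat.log 2 (k + 1) + 1 with hN
  have hNpos : (0 : ℝ) < (N : ℕ) := by positivity
  -- Each of the N classes is allowed failure probability 1/(6N). In class l the ambiguity count
  -- plus one lies in [2^l, 2^(l+1)): the upper end bounds the number of codes, the lower end forces
  -- a large cost.
  have hclass : ∀ l ∈ Finset.range N,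
      prob P A σ (badCosts P A σ m ε (ambiguityClass A l)) ≤ 1 / (6 * N) := by
    intro l hl
    have hlk : 2 ^ l ≤ k + 1 := by
      have : l ≤ Nat.log 2 (k + 1) := by have := Finset.mem_range.mp hl; omega
      exact (Nat.pow_le_pow_right (by norm_num) this).trans (Nat.pow_log_le_self 2 (by omega))
    set M := max 1 (((2 : ℝ) ^ l - 1) * (β / (8 * (3 + 4 * γ)))) with hM
    have hM1 : 1 ≤ M := le_max_left _ _
    have h1 := prob_badCosts_le (m := m) hP hσ hcA hk hkm (2 ^ (l + 1)) hε
      (K := opt P k * M) (ambiguityClass A l)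
      (fun S hS => by
        have h := Nat.lt_pow_succ_log_self (b := 2) (by norm_num) ((ambiguous A S).card + 1)
        rw [show Nat.log 2 ((ambiguous A S).card + 1) = l from hS] at h
        omega)
      (fun S hS => opt_mul_max_le_cost hγ hβ hst hσ hA S (by
        have h := Nat.pow_log_le_self 2 (show (ambiguous A S).card + 1 ≠ 0 by omega)
        rwa [show Nat.log 2 ((ambiguous A S).card + 1) = l from hS] at h)) H
    have h2 := mul_le_mul_of_nonneg_left (hH l hlk) hopt.le
    rw [← hM] at h2
    have hγcost : cost P A ≤ γ * opt P k := hA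
    set R := √(m * (132 * k * (1 + (2 ^ (l + 1) : ℕ)) * (Real.log (3000 * m) + 2 * H))) with hR
    have h3 : 2 * (8 * H * (34 * (4 * cost P A)) * R + 34 * (4 * cost P A) * m / 2 ^ H) ≤
        opt P k * (2 * (8 * H * (34 * (4 * γ)) * R + 34 * (4 * γ) * m / 2 ^ H)) := by
      have hQ : 0 ≤ 2 * (8 * H * (34 * 4) * R + 34 * 4 * m / 2 ^ H) := by positivity
      calc _ = cost P A * (2 * (8 * H * (34 * 4) * R + 34 * 4 * m / 2 ^ H)) := by ring
        _ ≤ γ * opt P k * (2 * (8 * H * (34 * 4) * R + 34 * 4 * m / 2 ^ H)) := by gcongr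
        _ = _ := by ring
    have h4 := (h1.trans h3).trans h2
    have h5 : opt P k * (m * (ε / 2) * M / (6 * N)) = 1 / (6 * N) * (m * (ε / 2) * (opt P k * M)) := by
      ring
    rw [h5] at h4
    exact le_of_mul_le_mul_right h4 (by positivity)
  refine (prob_mono (badCosts_univ_subset ε)).trans ((prob_biUnion_le _ _).trans ?_)
  refine (Finset.sum_le_sum hclass).trans (le_of_eq ?_)
  rw [Finset.sum_const, Finset.card_range, nsmul_eq_mul]
  field_simp

end Main

end KMedian

theorem mainTheorem5 (γ : ℝ) (hγ : 1 ≤ γ) :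
    ∃ C : ℝ, 0 < C ∧ ∃ c : ℕ,
      ∀ (d k : ℕ), 1 ≤ k →
      ∀ (P : Finset (KMedian.Pt d)) (hP : P.Nonempty) (β : ℝ), 0 < β → KMedian.IsStable P k β →
      ∀ ε : ℝ, 0 < ε → ε < 1 →
      ∀ A : Fin k → KMedian.Pt d, KMedian.IsApprox γ P A →
      ∀ σ : KMedian.Pt d → Fin k, KMedian.IsNearest P A σ →
      ∀ m : ℕ,
        C * ((k : ℝ) / ε ^ 2 * max 1 (1 / β)) * (1 + Real.log ((k : ℝ) / ε)) ^ c ≤ (m : ℝ) →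
        2 / 3 ≤ (KMedian.sampleLaw P hP A σ m).real
          {q | KMedian.IsCoreset P k ε (fun i => (q i : KMedian.Pt d))
            (fun i => KMedian.sampleWeight P A σ m (q i))} := by
  obtain ⟨C, hC, hsize⟩ := KMedian.exists_sample_size_constant (γ := γ) (D := 8 * (3 + 4 * γ)) hγ
    (by linarith)
  refine ⟨C, hC, 5, fun d k hk P hP β hβ hst ε hε hε1 A hA σ hσ m hm => ?_⟩
  obtain ⟨hkm, hη, H, hH⟩ := hsize k m β ε hk hβ hε hε1 hm
  refine KMedian.two_thirds_le_of_prob_compl hP _ ?_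
  -- Failure requires a bad size estimate or a bad relative cost, each of probability at most 1/6.
  have hsub : {q | KMedian.IsCoreset P k ε (fun i => (q i : KMedian.Pt d))
      (fun i => KMedian.sampleWeight P A σ m (q i))}ᶜ ⊆
      KMedian.badSizes P A σ m (ε / (2 * (1 + γ))) ∪ KMedian.badCosts P A σ m ε Set.univ := by
    intro q hq
    by_contra hcon
    rw [Set.mem_union, not_or] at hcon
    exact hq (KMedian.isCoreset_of_notMem hσ (by omega) hε hγ hA hcon.1 hcon.2)
  have h1 : KMedian.prob P A σ (KMedian.badSizes P A σ m (ε / (2 * (1 + γ)))) ≤ 1 / 6 :=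
    KMedian.prob_badSizes_le hP hk (by omega) (by positivity)
      (by rw [div_le_one (by positivity)]; linarith) hη
  have h2 := KMedian.prob_badCosts_univ_le (m := m) hP hσ hγ hβ hε hst hA hk hkm H hH
  have h3 := (KMedian.prob_mono (A := A) (σ := σ) hsub).trans (KMedian.prob_union_le _ _)
  linarith
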